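/- Let $0<q<1$ and $[k]=\frac{1-q^k}{1-q}$. For $d\ge 1$ let $\mathcal U_d=\{(s_1,\dots,s_d)\in\mathbb C^d:\ \mathrm{Re}(s_1+\dots+s_j)>j \text{ for } 1\le j\le d\}$ and, on $\mathcal U_d$, $$\zeta_q^{BZ}(s_1,\dots,s_d)=\sum_{k_1>\dots>k_d\ge 1}\frac{q^{k_1(s_1-1)+\dots+k_d(s_d-1)}}{[k_1]^{s_1}\cdots[k_d]^{s_d}}.$$ For every $d\ge1$ this series converges normally on compact subsets of $\mathcal U_d$, and $\zeta_q^{BZ}$ extends to a meromorphic function on $\mathbb C^d$, denoted by the same symbol. For every $r\ge 2$ these functions satisfy $$\sum_{k\ge0}(-1)^k\frac{s_1(s_1+1)\cdots(s_1+k-1)}{k!}\Big(\zeta_q^{BZ}(s_1+s_2+k,s_3,\dots,s_r)+(1-q)\,\zeta_q^{BZ}(s_1+s_2+k-1,s_3,\dots,s_r)\Big)$$ $$=\sum_{k\ge0}(-1)^k\frac{s_1(s_1+1)\cdots(s_1+k)}{(k+1)!}\,\zeta_q^{BZ}(s_1+k+1,s_2,\dots,s_r)+\big(q^{-(s_1-1)}-1\big)\,\zeta_q^{BZ}(s_1,s_2,\dots,s_r)$$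 at every point of $\mathcal U_r$ and, more generally, at every point $(s_1,\dots,s_r)\in\mathbb C^r$ at which all the functions involved are holomorphic; both series in $k$ converge there. Both series in $k$, as series of functions of $(s_1,\dots,s_r)$, converge normally on every compact subset of $\mathcal U_r$. -/

import Mathlib

open Filter Topology

noncomputable section

namespace BZ

/-- The `q`-analogue `[k] = (1 - q ^ k) / (1 - q)` of the natural number `k`. -/
def qInt (q : ℝ) (k : ℕ) : ℝ := (1 - q ^ k) / (1 - q)

/-- The index set of all `(k₁, …, k_d)` with `k₁ > ⋯ > k_d ≥ 1`. -/
def Index (d : ℕ) : Type := {k : Fin d → ℕ // StrictAnti k ∧ ∀ i, 1 ≤ k i}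

/-- The summand `∏ i, q ^ (kᵢ (sᵢ - 1)) / [kᵢ] ^ sᵢ`. -/
def term (q : ℝ) (d : ℕ) (k : Index d) (s : Fin d → ℂ) : ℂ :=
  ∏ i, (q : ℂ) ^ ((k.1 i : ℂ) * (s i - 1)) / (qInt q (k.1 i) : ℂ) ^ s i

/-- The defining series of the BZ model in depth `d`. -/
def zeta (q : ℝ) (d : ℕ) (s : Fin d → ℂ) : ℂ := ∑' k : Index d, term q d k s

/-- The domain `Re (s₁ + ⋯ + s_j) > j` for `1 ≤ j ≤ d`. -/
def domain (d : ℕ) : Set (Fin d → ℂ) :=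
  {s | ∀ j : Fin d, ((j : ℕ) : ℝ) + 1 < (∑ i ∈ Finset.Iic j, s i).re}

/-- `f` represents a meromorphic function on `ℂ ^ d`: around every point it is a quotient `g / h`
of holomorphic functions, where the germ of `h` is not zero. The values of `f` where `h`
vanishes are not restricted. -/
def IsMeromorphic {d : ℕ} (f : (Fin d → ℂ) → ℂ) : Prop :=
  ∀ p, ∃ g h : (Fin d → ℂ) → ℂ, AnalyticAt ℂ g p ∧ AnalyticAt ℂ h p ∧
    (¬ ∀ᶠ z in 𝓝 p, h z = 0) ∧ ∀ᶠ z in 𝓝 p, h z ≠ 0 → f z = g z / h z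

/-- Normal convergence of the series `∑ i, f i` on `K`: the sup norms on `K` are summable. -/
def NormallyConvergentOn {ι X : Type*} (f : ι → X → ℂ) (K : Set X) : Prop :=
  ∃ u : ι → ℝ, Summable u ∧ ∀ i, ∀ x ∈ K, ‖f i x‖ ≤ u i

/-- The rising factorial `a (a + 1) ⋯ (a + k - 1)`. -/
def rising (a : ℂ) (k : ℕ) : ℂ := ∏ i ∈ Finset.range k, (a + i)

/-- The point `(s₁ + a, s₂, …, s_r)`, where `r = m + 2`. -/
def shift {m : ℕ} (s : Fin (m + 2) → ℂ) (a : ℂ) : Fin (m + 2) → ℂ :=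
  Fin.cons (s 0 + a) fun i => s i.succ

/-- The point `(s₁ + s₂ + a, s₃, …, s_r)`, where `r = m + 2`. -/
def merge {m : ℕ} (s : Fin (m + 2) → ℂ) (a : ℂ) : Fin (m + 1) → ℂ :=
  Fin.cons (s 0 + s 1 + a) fun i => s i.succ.succ

/-- The `k`-th term of the series on the left of the translation formula;
`G` is the function of depth `m + 1`. -/
def leftTerm (q : ℝ) {m : ℕ} (G : (Fin (m + 1) → ℂ) → ℂ) (k : ℕ) (s : Fin (m + 2) → ℂ) : ℂ :=
  (-1) ^ k * (rising (s 0) k / (k.factorial : ℂ)) *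
    (G (merge s (k : ℂ)) + (1 - (q : ℂ)) * G (merge s ((k : ℂ) - 1)))

/-- The `k`-th term of the series on the right of the translation formula;
`F` is the function of depth `m + 2`. -/
def rightTerm {m : ℕ} (F : (Fin (m + 2) → ℂ) → ℂ) (k : ℕ) (s : Fin (m + 2) → ℂ) : ℂ :=
  (-1) ^ k * (rising (s 0) (k + 1) / ((k + 1).factorial : ℂ)) * F (shift s ((k : ℂ) + 1))

/-- The translation formula at the point `s`, with convergence of both series. -/
def TranslationFormula (q : ℝ) {m : ℕ} (G : (Fin (m + 1) → ℂ) → ℂ)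
    (F : (Fin (m + 2) → ℂ) → ℂ) (s : Fin (m + 2) → ℂ) : Prop :=
  Summable (fun k : ℕ => leftTerm q G k s) ∧ Summable (fun k : ℕ => rightTerm F k s) ∧
    ∑' k : ℕ, leftTerm q G k s =
      (∑' k : ℕ, rightTerm F k s) + ((q : ℂ) ^ (-(s 0 - 1)) - 1) * F s

/-- All the functions in the translation formula are holomorphic near the points where they are
evaluated, that is, `s` avoids their poles. (The arguments `merge s k` are of the form
`merge s (k' - 1)` with `k' = k + 1`.) -/
def IsRegularPoint {m : ℕ} (G : (Fin (m + 1) → ℂ) → ℂ)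
    (F : (Fin (m + 2) → ℂ) → ℂ) (s : Fin (m + 2) → ℂ) : Prop :=
  AnalyticAt ℂ F s ∧ (∀ k : ℕ, AnalyticAt ℂ F (shift s ((k : ℂ) + 1))) ∧
    ∀ k : ℕ, AnalyticAt ℂ G (merge s ((k : ℂ) - 1))

end BZ

end

noncomputable section

namespace BZ

/-! On the domain of the series the formula is a telescoping identity. Write f(n, s) =
q^(n(s-1))/[n]^s and ρ = q^n/[n]. Three facts suffice: f(n, s+k) = f(n, s) ρ^k; f(n, a) f(n, b) =
f(n, a+b) + (1-q) f(n, a+b-1), because ρ + (1-q) = 1/[n] (`fac_mul_fac`); and f(n, s) (1+ρ)^(-s) =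
q^(1-s) f(n+1, s), because [n+1] = [n](1+ρ) (`fac_mul_one_add_ratio_cpow`). The series in k are
binomial expansions of (1+ρ)^(-s₁) inside the multiple sum. On the left this produces q^(1-s₁)
f(k₂+1, s₁) in front of the summand of (s₂, …, s_r). On the right, together with the boundary term,
it produces differences of consecutive f(k₁, s₁), whose sum over k₁ > k₂ is the same expression
(`tsum_leftTerm_zeta`, `tsum_rightTerm_zeta`).

For the continuation, (1 - q^k)^(-s) is expanded in powers of q^k and the geometric series over the
gaps between the kᵢ are summed, which gives the recursion `cont`. Its poles come from the factors 1
- q^(w+L), where w is a partial sum of the sᵢ - 1. On a region where the real parts of these w are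
bounded below, only finitely many factors can vanish. After multiplication by them the recursion
becomes an application of holomorphic operators to bounded sequences (`numer_eq`,
`analyticAt_numer`), so that `cont` is locally a quotient of holomorphic functions.

The formula is continued along the line through s in the direction of s₁. Moving far to the right on
it reaches the domain, and the poles met on it are countable, so their complement is connected and
the identity theorem applies (`tsum_eq_on_line`). Regular points that lie on a cancelled pole follow
by continuity, because the complement is dense. -/

/-! ### Binomial coefficients and the series of (1 - x)^(-s) -/

/-- The coefficient of `x ^ b` in the expansion of `(1 - x) ^ (-s)`. -/
def rcoef (s : ℂ) (b : ℕ) : ℂ := rising s b / (b.factorial : ℂ)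

theorem rising_succ (s : ℂ) (b : ℕ) : rising s (b + 1) = rising s b * (s + b) := by
  simp [rising, Finset.prod_range_succ]

theorem rising_zero (s : ℂ) : rising s 0 = 1 := by simp [rising]

theorem rcoef_zero (s : ℂ) : rcoef s 0 = 1 := by simp [rcoef, rising_zero]

theorem rcoef_eq_choose (s : ℂ) (b : ℕ) : rcoef s b = Ring.choose (s + b - 1) b := by
  have h1 : (ascPochhammer ℕ b).smeval s = rising s b := by
    induction b with
    | zero => simp [rising_zero]
    | succ b ih =>
      rw [ascPochhammer_succ_right, mul_comm, rising_succ, ← ih, mul_comm]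
      simp [Polynomial.smeval_mul, Polynomial.smeval_natCast]
  have h2 := Ring.factorial_nsmul_multichoose_eq_ascPochhammer s b
  rw [h1] at h2
  have h3 : (b.factorial : ℂ) ≠ 0 := by exact_mod_cast b.factorial_ne_zero
  rw [rcoef, ← h2, Ring.choose]
  have : s + b - 1 - b + 1 = s := by ring
  rw [this, nsmul_eq_mul]
  field_simp

theorem hasSum_rcoef (s : ℂ) {x : ℂ} (hx : ‖x‖ < 1) :
    HasSum (fun b => rcoef s b * x ^ b) ((1 - x) ^ (-s)) := by
  have h := (Complex.one_div_one_sub_cpow_hasFPowerSeriesOnBall_zero s).hasSum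
    (y := x) (by
      rw [← ENNReal.ofReal_one, Metric.eball_ofReal]; simpa using hx)
  simpa [FormalMultilinearSeries.ofScalars_apply_eq, ← rcoef_eq_choose, Complex.cpow_neg,
    mul_comm] using h

/-- Each factor satisfies |s + i| ≤ R + i. The majorant no longer depends on s and is itself the
coefficient of a binomial series, hence summable against powers of any x in [0, 1). -/
theorem norm_rcoef_le {s : ℂ} {R : ℝ} (h : ‖s‖ ≤ R) (b : ℕ) : ‖rcoef s b‖ ≤ ‖rcoef (R : ℂ) b‖ := by
  have hR : 0 ≤ R := (norm_nonneg _).trans h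
  rw [rcoef, rcoef, norm_div, norm_div, rising, rising, norm_prod, norm_prod]
  gcongr with i
  calc ‖s + i‖ ≤ ‖s‖ + ‖(i : ℂ)‖ := norm_add_le _ _
    _ ≤ R + i := by simpa using h
    _ = ‖(R : ℂ) + i‖ := by
      rw [← Complex.ofReal_natCast, ← Complex.ofReal_add, Complex.norm_real,
        Real.norm_of_nonneg (by positivity)]

theorem summable_norm_rcoef_mul_pow (R : ℝ) {x : ℝ} (hx0 : 0 ≤ x) (hx1 : x < 1) :
    Summable fun b => ‖rcoef (R : ℂ) b‖ * x ^ b := by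
  have h := (hasSum_rcoef (R : ℂ) (x := (x : ℂ)) (by simpa [abs_of_nonneg hx0] using hx1)).summable.norm
  simpa [abs_of_nonneg hx0] using h

/-! ### Identities and bounds for a single factor of the summand -/

section

variable {q : ℝ} (hq0 : 0 < q) (hq1 : q < 1)

/-- One factor `q ^ (n (s - 1)) / [n] ^ s` of the summand. -/
def fac (q : ℝ) (n : ℕ) (s : ℂ) : ℂ := (q : ℂ) ^ ((n : ℂ) * (s - 1)) / (qInt q n : ℂ) ^ s

/-- The ratio `q ^ n / [n]`. -/
def ratio (q : ℝ) (n : ℕ) : ℝ := q ^ n / qInt q n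

include hq0 in
theorem ofReal_q_ne_zero : (q : ℂ) ≠ 0 := by exact_mod_cast hq0.ne'

include hq0 hq1

theorem one_le_qInt {n : ℕ} (hn : 1 ≤ n) : 1 ≤ qInt q n := by
  rw [qInt, le_div_iff₀ (by linarith)]
  have := pow_le_pow_of_le_one hq0.le hq1.le hn
  simp only [pow_one] at this
  linarith

theorem qInt_le (n : ℕ) : qInt q n ≤ (1 - q)⁻¹ := by
  rw [qInt, div_eq_mul_inv]
  have h1 : 0 < q ^ n := by positivity
  have h2 : 0 ≤ (1 - q)⁻¹ := inv_nonneg.2 (by linarith)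
  nlinarith

theorem qInt_pos {n : ℕ} (hn : 1 ≤ n) : 0 < qInt q n :=
  zero_lt_one.trans_le (one_le_qInt hq0 hq1 hn)

theorem ratio_pos {n : ℕ} (hn : 1 ≤ n) : 0 < ratio q n :=
  div_pos (pow_pos hq0 n) (qInt_pos hq0 hq1 hn)

theorem ratio_le {n : ℕ} (hn : 1 ≤ n) : ratio q n ≤ q := by
  have h1 := one_le_qInt hq0 hq1 hn
  have := pow_le_pow_of_le_one hq0.le hq1.le hn
  simp only [pow_one] at this
  rw [ratio, div_le_iff₀ (by linarith)]
  nlinarith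

theorem fac_add_natCast {n : ℕ} (hn : 1 ≤ n) (s : ℂ) (k : ℕ) :
    fac q n (s + k) = fac q n s * (ratio q n : ℂ) ^ k := by
  have hq := ofReal_q_ne_zero hq0
  have hi : (qInt q n : ℂ) ≠ 0 := by exact_mod_cast (qInt_pos hq0 hq1 hn).ne'
  rw [fac, fac, Complex.cpow_add _ _ hi, Complex.cpow_natCast,
    show (n : ℂ) * (s + k - 1) = n * (s - 1) + ((n * k : ℕ) : ℂ) by push_cast; ring,
    Complex.cpow_add _ _ hq, Complex.cpow_natCast, ratio]
  push_cast
  rw [div_pow, pow_mul, div_mul_div_comm]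

/-- Rests on q^n/[n] + (1 - q) = 1/[n]. It accounts for the pair of values in each term on the left
of the translation formula. -/
theorem fac_mul_fac {n : ℕ} (hn : 1 ≤ n) (a b : ℂ) :
    fac q n a * fac q n b = fac q n (a + b) + (1 - q) * fac q n (a + b - 1) := by
  have hq := ofReal_q_ne_zero hq0
  have hi : (qInt q n : ℂ) ≠ 0 := by exact_mod_cast (qInt_pos hq0 hq1 hn).ne'
  have h1 := fac_add_natCast hq0 hq1 hn (a + b - 1) 1
  have h2 : (ratio q n : ℂ) + (1 - q) = (qInt q n : ℂ)⁻¹ := by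
    have : ratio q n + (1 - q) = (qInt q n)⁻¹ := by
      have h3 := (qInt_pos hq0 hq1 hn).ne'
      rw [ratio]
      field_simp
      rw [qInt]
      have : 1 - q ≠ 0 := by linarith
      field_simp
      ring
    exact_mod_cast this
  rw [show a + b - 1 + ((1 : ℕ) : ℂ) = a + b by push_cast; ring, pow_one] at h1
  rw [h1, mul_comm (1 - (q : ℂ)), ← mul_add, h2, fac, fac, fac, div_mul_div_comm,
    ← Complex.cpow_add _ _ hq, ← Complex.cpow_add _ _ hi,
    show (n : ℂ) * (a - 1) + n * (b - 1) = n * (a + b - 1 - 1) by ring,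
    ← div_eq_mul_inv, div_div]
  congr 1
  conv_lhs => rw [show a + b = a + b - 1 + 1 by ring, Complex.cpow_add _ _ hi, Complex.cpow_one]

/-- Rests on [n+1] = [n] + q^n = [n](1 + q^n/[n]). All bases are positive reals, so complex powers
are multiplicative. -/
theorem fac_mul_one_add_ratio_cpow {n : ℕ} (hn : 1 ≤ n) (s : ℂ) :
    fac q n s * (1 + (ratio q n : ℂ)) ^ (-s) = (q : ℂ) ^ (1 - s) * fac q (n + 1) s := by
  have hq := ofReal_q_ne_zero hq0
  have h0 := qInt_pos hq0 hq1 hn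
  have h1 := ratio_pos hq0 hq1 hn
  have h2 : (qInt q (n + 1) : ℂ) = (qInt q n : ℂ) * ((1 + ratio q n : ℝ) : ℂ) := by
    have : qInt q (n + 1) = qInt q n * (1 + ratio q n) := by
      rw [ratio, mul_add, mul_div_cancel₀ _ h0.ne', qInt, qInt]
      have : 1 - q ≠ 0 := by linarith
      field_simp
      ring
    exact_mod_cast this
  rw [fac, fac, h2, Complex.mul_cpow_ofReal_nonneg h0.le (by positivity), Complex.cpow_neg,
    mul_div_assoc', ← Complex.cpow_add _ _ hq, ← div_eq_mul_inv, div_div]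
  push_cast
  congr 2
  ring

theorem fac_eq {n : ℕ} (hn : 1 ≤ n) (s : ℂ) :
    fac q n s = (1 - (q : ℂ)) ^ s * ((q : ℂ) ^ ((n : ℂ) * (s - 1)) * (1 - (q : ℂ) ^ n) ^ (-s)) := by
  have hn' : 0 < 1 - q ^ n := by
    have := pow_lt_one₀ hq0.le hq1 (n := n) (by omega); linarith
  have hq' : 0 < 1 - q := by linarith
  have h : (1 - (q : ℂ) ^ n) = (((1 - q) : ℝ) : ℂ) * (qInt q n : ℂ) := by
    rw [qInt]; push_cast
    have : (1 - (q : ℂ)) ≠ 0 := by exact_mod_cast hq'.ne'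
    field_simp
  rw [h, Complex.mul_cpow_ofReal_nonneg hq'.le (qInt_pos hq0 hq1 hn).le, fac]
  push_cast
  have h3 : (1 - (q : ℂ)) ^ s ≠ 0 := by
    rw [Complex.cpow_ne_zero_iff]; left; exact_mod_cast hq'.ne'
  rw [Complex.cpow_neg (1 - (q : ℂ)), Complex.cpow_neg]
  field_simp

/-- Since 1 ≤ [n] ≤ 1/(1-q), the denominator costs only a constant, whatever the sign of Re s. -/
theorem norm_fac_le {n : ℕ} (hn : 1 ≤ n) {s : ℂ} {R : ℝ} (hs : ‖s‖ ≤ R) :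
    ‖fac q n s‖ ≤ ((1 - q)⁻¹) ^ R * q ^ ((n : ℝ) * (s.re - 1)) := by
  have h0 := qInt_pos hq0 hq1 hn
  have h1 := qInt_le hq0 hq1 n
  have h2 : 1 ≤ (1 - q)⁻¹ := (one_le_qInt hq0 hq1 hn).trans h1
  have hre : -s.re ≤ R := (neg_le_abs _).trans ((Complex.abs_re_le_norm s).trans hs)
  have hR : 0 ≤ R := (norm_nonneg _).trans hs
  rw [fac, norm_div, Complex.norm_cpow_eq_rpow_re_of_pos hq0, Complex.norm_cpow_eq_rpow_re_of_pos h0,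
    div_eq_mul_inv, ← Real.rpow_neg h0.le, mul_comm]
  have h3 : ((n : ℂ) * (s - 1)).re = n * (s.re - 1) := by simp
  rw [h3]
  gcongr
  calc (qInt q n) ^ (-s.re) ≤ (qInt q n) ^ R :=
        Real.rpow_le_rpow_of_exponent_le (one_le_qInt hq0 hq1 hn) hre
    _ ≤ _ := Real.rpow_le_rpow h0.le h1 hR

end

/-! ### Index tuples as a tail together with a gap -/

/-- The largest entry `k₁`, or `0` in depth `0`. -/
def head : {d : ℕ} → Index d → ℕ
  | 0, _ => 0
  | _ + 1, k => k.1 0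

theorem apply_le_head {d : ℕ} (k : Index d) (i : Fin d) : k.1 i ≤ head k := by
  cases d with
  | zero => exact i.elim0
  | succ d => exact k.2.1.antitone (Fin.zero_le i)

/-- Index tuples of depth `d + 1` are given by their tail and the gap below the first entry. -/
def indexEquiv (d : ℕ) : Index d × ℕ ≃ Index (d + 1) where
  toFun p := ⟨Fin.cons (head p.1 + 1 + p.2) p.1.1, by
    constructor
    · intro i j hij
      induction j using Fin.cases with
      | zero => exact absurd hij (Fin.not_lt_zero i)
      | succ j =>
        induction i using Fin.cases with
        | zero => have := apply_le_head p.1 j; simp; omega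
        | succ i => simpa using p.1.2.1 (Fin.succ_lt_succ_iff.1 hij)
    · intro i
      induction i using Fin.cases with
      | zero => simp; omega
      | succ i => simpa using p.1.2.2 i⟩
  invFun k := (⟨Fin.tail k.1, fun i j hij => k.2.1 (Fin.succ_lt_succ_iff.2 hij),
    fun i => k.2.2 i.succ⟩, k.1 0 - 1 - head (d := d) ⟨Fin.tail k.1, fun i j hij =>
      k.2.1 (Fin.succ_lt_succ_iff.2 hij), fun i => k.2.2 i.succ⟩)
  left_inv p := by
    refine Prod.ext (Subtype.ext (by simp)) ?_
    show head p.1 + 1 + p.2 - 1 - head p.1 = p.2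
    omega
  right_inv k := by
    refine Subtype.ext ?_
    have h : head (d := d) ⟨Fin.tail k.1, fun i j hij =>
      k.2.1 (Fin.succ_lt_succ_iff.2 hij), fun i => k.2.2 i.succ⟩ < k.1 0 := by
      cases d with
      | zero => exact k.2.2 0
      | succ d => exact k.2.1 (show (0 : Fin (d + 2)) < Fin.succ 0 from Fin.succ_pos _)
    refine Eq.trans ?_ (Fin.cons_self_tail k.1)
    show (Fin.cons (head (d := d) ⟨Fin.tail k.1, fun i j hij =>
      k.2.1 (Fin.succ_lt_succ_iff.2 hij), fun i => k.2.2 i.succ⟩ + 1 + (k.1 0 - 1 -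
      head (d := d) ⟨Fin.tail k.1, fun i j hij => k.2.1 (Fin.succ_lt_succ_iff.2 hij),
        fun i => k.2.2 i.succ⟩)) (Fin.tail k.1) : Fin (d + 1) → ℕ) = _
    congr 1
    generalize head (d := d) ⟨Fin.tail k.1, _⟩ = a at h ⊢
    omega

theorem head_indexEquiv {d : ℕ} (p : Index d × ℕ) :
    head (indexEquiv d p) = head p.1 + 1 + p.2 := rfl

theorem term_indexEquiv (q : ℝ) {d : ℕ} (p : Index d × ℕ) (s : Fin (d + 1) → ℂ) :
    term q (d + 1) (indexEquiv d p) s =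
      fac q (head p.1 + 1 + p.2) (s 0) * term q d p.1 (Fin.tail s) := by
  rw [term, Fin.prod_univ_succ]
  rfl

instance : Unique (Index 0) where
  default := ⟨Fin.elim0, fun i => i.elim0, fun i => i.elim0⟩
  uniq _ := Subtype.ext (funext fun i => i.elim0)

theorem term_zero (q : ℝ) (k : Index 0) (s : Fin 0 → ℂ) : term q 0 k s = 1 := by simp [term]

/-! ### The domain, with an offset suited to induction on the depth -/

/-- All partial sums `x + (s₁ - 1) + ⋯ + (s_j - 1)` have real part greater than `a`. -/
def Above : (d : ℕ) → ℝ → ℂ → (Fin d → ℂ) → Prop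
  | 0, _, _, _ => True
  | d + 1, a, x, s => a < (x + s 0 - 1).re ∧ Above d a (x + s 0 - 1) (Fin.tail s)

theorem Above.mono {d : ℕ} {a b : ℝ} (hab : a ≤ b) {x : ℂ} {s : Fin d → ℂ} (h : Above d b x s) :
    Above d a x s := by
  induction d generalizing x with
  | zero => trivial
  | succ d ih => exact ⟨hab.trans_lt h.1, ih h.2⟩

theorem Above.add_right {d : ℕ} {a : ℝ} {x : ℂ} {s : Fin d → ℂ} (h : Above d a x s) {y : ℂ}
    {b : ℝ} (hy : b ≤ y.re) : Above d (a + b) (x + y) s := by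
  induction d generalizing x with
  | zero => trivial
  | succ d ih =>
    have e : x + y + s 0 - 1 = x + s 0 - 1 + y := by ring
    refine ⟨?_, ?_⟩
    · rw [e, Complex.add_re]; linarith [h.1]
    · rw [e]; exact ih h.2

theorem Above.add_natCast {d : ℕ} {a : ℝ} {x : ℂ} {s : Fin d → ℂ} (h : Above d a x s) (n : ℕ) :
    Above d a (x + n) s :=
  (h.add_right (y := n) (b := 0) (by simp)).mono (by simp)

theorem Above.exists_pos {d : ℕ} {x : ℂ} {s : Fin d → ℂ} (h : Above d 0 x s) :
    ∃ δ > 0, Above d δ x s := by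
  induction d generalizing x with
  | zero => exact ⟨1, one_pos, trivial⟩
  | succ d ih =>
    obtain ⟨δ, hδ, h'⟩ := ih h.2
    refine ⟨min δ ((x + s 0 - 1).re / 2), lt_min hδ (half_pos h.1), ?_, h'.mono (min_le_left _ _)⟩
    exact (min_le_right _ _).trans_lt (half_lt_self h.1)

theorem exists_above (d : ℕ) (x : ℂ) (s : Fin d → ℂ) : ∃ N : ℕ, Above d (-N) x s := by
  induction d generalizing x with
  | zero => exact ⟨0, trivial⟩
  | succ d ih =>
    obtain ⟨N, hN⟩ := ih (x + s 0 - 1) (Fin.tail s)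
    obtain ⟨M, hM⟩ := exists_nat_gt (-(x + s 0 - 1).re)
    refine ⟨max N M, ?_, hN.mono (by simp)⟩
    have : (M : ℝ) ≤ ((max N M : ℕ) : ℝ) := by exact_mod_cast le_max_right _ _
    linarith

/-- The change of variables from depth `d + 1` to depth `d`. -/
def stepMap (d : ℕ) (p : ℂ × (Fin (d + 1) → ℂ)) : ℂ × (Fin d → ℂ) :=
  (p.1 + p.2 0 - 1, Fin.tail p.2)

theorem continuous_stepMap (d : ℕ) : Continuous (stepMap d) := by
  unfold stepMap Fin.tail
  fun_prop

theorem isOpen_above (d : ℕ) (a : ℝ) : IsOpen {p : ℂ × (Fin d → ℂ) | Above d a p.1 p.2} := by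
  induction d with
  | zero => exact isOpen_univ
  | succ d ih =>
    refine IsOpen.and ?_ (ih.preimage (continuous_stepMap d))
    exact isOpen_lt continuous_const (by fun_prop)

/-- The partial sum ending at the zero-based index j subtracts 1 exactly j + 1 times. This is where
the bounds 1, …, d in the domain come from. -/
theorem above_iff (d : ℕ) (a : ℝ) (x : ℂ) (s : Fin d → ℂ) :
    Above d a x s ↔ ∀ j : Fin d, a + ((j : ℕ) : ℝ) + 1 < (x + ∑ i ∈ Finset.Iic j, s i).re := by
  induction d generalizing x with
  | zero => simp [Above]
  | succ d ih =>
    have e0 : Finset.Iic (0 : Fin (d + 1)) = {0} := by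
      ext i; simp
    have e1 (j : Fin d) : ∑ i ∈ Finset.Iic j.succ, s i = s 0 + ∑ i ∈ Finset.Iic j, s i.succ := by
      rw [Finset.sum_filter_add_sum_filter_not (Finset.Iic j.succ) (fun i => i = 0) s |>.symm]
      congr 1
      · rw [Finset.sum_filter, Finset.sum_ite_eq' ]
        simp
      · symm
        refine Finset.sum_bij (fun i _ => i.succ) ?_ ?_ ?_ ?_
        · intro i hi; simpa [Fin.succ_ne_zero] using hi
        · intro i _ k _ h; simpa using h
        · intro b hb
          simp only [Finset.mem_filter, Finset.mem_Iic] at hb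
          obtain ⟨c, rfl⟩ := Fin.exists_succ_eq.2 hb.2
          exact ⟨c, by simpa using hb.1, rfl⟩
        · intros; rfl
    rw [Fin.forall_fin_succ]
    simp only [Above, ih, e0, e1, Finset.sum_singleton, Fin.val_zero, Fin.val_succ]
    refine and_congr ?_ (forall_congr' fun j => ?_)
    · simp only [Complex.sub_re, Complex.one_re, Nat.cast_zero]
      constructor <;> intro h <;> linarith
    · simp only [Complex.add_re, Complex.sub_re, Complex.one_re, Nat.cast_add, Nat.cast_one,
        Fin.tail]
      constructor <;> intro h <;> linarith

theorem mem_domain_iff {d : ℕ} {s : Fin d → ℂ} : s ∈ domain d ↔ Above d 0 0 s := by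
  rw [above_iff]
  simp [domain]

theorem isOpen_domain (d : ℕ) : IsOpen (domain d) := by
  have : domain d = (fun s => ((0 : ℂ), s)) ⁻¹' {p : ℂ × (Fin d → ℂ) | Above d 0 p.1 p.2} := by
    ext s; exact mem_domain_iff
  rw [this]
  exact (isOpen_above d 0).preimage (by fun_prop)

/-- The open conditions with margin 1/(n+1) increase with n and cover the compact set, so one of
them already contains it. -/
theorem exists_pos_of_isCompact {d : ℕ} {K : Set (Fin d → ℂ)} (hK : IsCompact K)
    (h : K ⊆ domain d) : ∃ δ > 0, ∀ s ∈ K, Above d δ 0 s := by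
  have ho (n : ℕ) : IsOpen {s : Fin d → ℂ | Above d (1 / ((n : ℝ) + 1)) 0 s} :=
    (isOpen_above d (1 / ((n : ℝ) + 1))).preimage (f := fun s => ((0 : ℂ), s)) (by fun_prop)
  obtain ⟨n, hn⟩ := hK.elim_directed_cover _ ho (fun s hs => by
    obtain ⟨δ, hδ, h'⟩ := (mem_domain_iff.1 (h hs)).exists_pos
    obtain ⟨n, hn⟩ := exists_nat_one_div_lt hδ
    exact Set.mem_iUnion.2 ⟨n, h'.mono hn.le⟩) (directed_of_isDirected_le fun m n hmn s hs =>
      hs.mono (Nat.one_div_le_one_div hmn))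
  exact ⟨1 / ((n : ℝ) + 1), by positivity, hn⟩

/-! ### Normal convergence of the defining series -/

section

variable {q : ℝ} (hq0 : 0 < q) (hq1 : q < 1)

/-- The summand `q ^ (k₁ x) ∏ i, q ^ (kᵢ (sᵢ - 1)) / [kᵢ] ^ sᵢ`. -/
def offsetTerm (q : ℝ) (d : ℕ) (x : ℂ) (k : Index d) (s : Fin d → ℂ) : ℂ :=
  (q : ℂ) ^ ((head k : ℂ) * x) * term q d k s

theorem offsetTerm_zero_left (q : ℝ) (d : ℕ) (k : Index d) (s : Fin d → ℂ) :
    offsetTerm q d 0 k s = term q d k s := by simp [offsetTerm]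

theorem offsetTerm_indexEquiv (q : ℝ) {d : ℕ} (x : ℂ) (p : Index d × ℕ) (s : Fin (d + 1) → ℂ) :
    offsetTerm q (d + 1) x (indexEquiv d p) s =
      (q : ℂ) ^ (((head p.1 + 1 + p.2 : ℕ) : ℂ) * x) * fac q (head p.1 + 1 + p.2) (s 0) *
        term q d p.1 (Fin.tail s) := by
  rw [offsetTerm, head_indexEquiv, term_indexEquiv, mul_assoc]

include hq0 hq1

/-- The outer variable is the head of the tail plus 1 plus the gap. The power of q belonging to the
head becomes the offset of the tail term; the rest is geometric in the gap. The offset is carried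
along so that the induction on depth closes. -/
theorem norm_offsetTerm_indexEquiv_le {d : ℕ} {x : ℂ} {s : Fin (d + 1) → ℂ} {δ R : ℝ}
    (hs : ‖s 0‖ ≤ R) (hx : δ ≤ (x + s 0 - 1).re) (p : Index d × ℕ) :
    ‖offsetTerm q (d + 1) x (indexEquiv d p) s‖ ≤
      ‖offsetTerm q d (x + s 0 - 1) p.1 (Fin.tail s)‖ *
        (((1 - q)⁻¹) ^ R * q ^ δ * (q ^ δ) ^ p.2) := by
  rw [offsetTerm_indexEquiv, offsetTerm, norm_mul, norm_mul, norm_mul,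
    Complex.norm_cpow_eq_rpow_re_of_pos hq0, Complex.norm_cpow_eq_rpow_re_of_pos hq0]
  set n := head p.1 + 1 + p.2 with hn
  have h1 := norm_fac_le hq0 hq1 (n := n) (by omega) hs
  set w := (x + s 0 - 1).re with hw
  have hw' : x.re + ((s 0).re - 1) = w := by rw [hw]; simp; ring
  have e1 : ((n : ℂ) * x).re = n * x.re := by simp
  have e2 : ((head p.1 : ℂ) * (x + s 0 - 1)).re = head p.1 * w := by rw [hw]; simp
  rw [e1, e2]
  have h2 : q ^ (n * x.re) * (((1 - q)⁻¹) ^ R * q ^ ((n : ℝ) * ((s 0).re - 1)))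
      = ((1 - q)⁻¹) ^ R * (q ^ (head p.1 * w) * q ^ ((1 + p.2 : ℕ) * w)) := by
    rw [mul_left_comm, ← Real.rpow_add hq0, ← Real.rpow_add hq0, ← hw', hn]
    push_cast
    congr 2
    ring
  have h3 : q ^ (((1 + p.2 : ℕ) : ℝ) * w) ≤ q ^ δ * (q ^ δ) ^ p.2 := by
    rw [← pow_succ', ← Real.rpow_mul_natCast hq0.le]
    refine Real.rpow_le_rpow_of_exponent_ge hq0 hq1.le ?_
    rw [mul_comm, add_comm]
    gcongr
  have h0 : 0 < 1 - q := by linarith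
  calc q ^ (n * x.re) * ‖fac q n (s 0)‖ * ‖term q d p.1 (Fin.tail s)‖
      ≤ q ^ (n * x.re) * (((1 - q)⁻¹) ^ R * q ^ ((n : ℝ) * ((s 0).re - 1))) *
          ‖term q d p.1 (Fin.tail s)‖ := by gcongr
    _ = ((1 - q)⁻¹) ^ R * (q ^ (head p.1 * w) * q ^ ((1 + p.2 : ℕ) * w)) *
          ‖term q d p.1 (Fin.tail s)‖ := by rw [h2]
    _ ≤ ((1 - q)⁻¹) ^ R * (q ^ (head p.1 * w) * (q ^ δ * (q ^ δ) ^ p.2)) *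
          ‖term q d p.1 (Fin.tail s)‖ := by gcongr
    _ = _ := by ring

theorem exists_summable_bound (d : ℕ) {δ : ℝ} (hδ : 0 < δ) (R : ℝ) :
    ∃ u : Index d → ℝ, Summable u ∧ ∀ x s, Above d δ x s → (∀ i, ‖s i‖ ≤ R) →
      ∀ k, ‖offsetTerm q d x k s‖ ≤ u k := by
  induction d with
  | zero =>
    refine ⟨fun _ => 1, (hasSum_unique _).summable, fun x s _ _ k => ?_⟩
    simp [offsetTerm, head, term_zero]
  | succ d ih =>
    obtain ⟨u, hu, hb⟩ := ih
    have hr : q ^ δ < 1 := Real.rpow_lt_one hq0.le hq1 hδ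
    have hr0 : 0 < q ^ δ := Real.rpow_pos_of_pos hq0 δ
    have h0 : 0 < 1 - q := by linarith
    have hg : Summable fun j : ℕ => ((1 - q)⁻¹) ^ R * q ^ δ * (q ^ δ) ^ j :=
      (summable_geometric_of_lt_one hr0.le hr).mul_left _
    have hs := hu.abs.mul_of_nonneg hg (fun k => abs_nonneg _) (fun j => by positivity)
    refine ⟨_, (indexEquiv d).symm.summable_iff.2 hs, fun x s hA hR k => ?_⟩
    obtain ⟨p, rfl⟩ := (indexEquiv d).surjective k
    refine (norm_offsetTerm_indexEquiv_le hq0 hq1 (hR 0) hA.1.le p).trans ?_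
    simp only [Function.comp, Equiv.symm_apply_apply]
    gcongr
    exact (hb _ _ hA.2 (fun i => hR i.succ) p.1).trans (le_abs_self _)

theorem summable_norm_offsetTerm {d : ℕ} {x : ℂ} {s : Fin d → ℂ} (h : Above d 0 x s) :
    Summable fun k => ‖offsetTerm q d x k s‖ := by
  obtain ⟨δ, hδ, h'⟩ := h.exists_pos
  obtain ⟨u, hu, hb⟩ := exists_summable_bound hq0 hq1 d hδ ‖s‖
  exact hu.of_nonneg_of_le (fun _ => norm_nonneg _) (hb x s h' (norm_le_pi_norm s))

theorem summable_norm_term {d : ℕ} {s : Fin d → ℂ} (h : s ∈ domain d) :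
    Summable fun k => ‖term q d k s‖ := by
  simpa [offsetTerm_zero_left] using summable_norm_offsetTerm hq0 hq1 (mem_domain_iff.1 h)

theorem normallyConvergentOn_term {d : ℕ} {K : Set (Fin d → ℂ)} (hK : IsCompact K)
    (h : K ⊆ domain d) : NormallyConvergentOn (term q d) K := by
  obtain ⟨δ, hδ, hA⟩ := exists_pos_of_isCompact hK h
  obtain ⟨R, hR⟩ := hK.isBounded.exists_norm_le
  obtain ⟨u, hu, hb⟩ := exists_summable_bound hq0 hq1 d hδ R
  refine ⟨u, hu, fun k s hs => ?_⟩
  simpa [offsetTerm_zero_left] using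
    hb 0 s (hA s hs) (fun i => (norm_le_pi_norm s i).trans (hR s hs)) k

/-! ### The recursive formula for the continuation -/

omit hq0 hq1 in
/-- The sum `∑ j ≥ 1, q ^ (j w) = q ^ w / (1 - q ^ w)`. -/
def geom (q : ℝ) (w : ℂ) : ℂ := (q : ℂ) ^ w / (1 - (q : ℂ) ^ w)

omit hq0 hq1 in
/-- The continuation of `∑ k, q ^ (k₁ x) ∏ i, q ^ (kᵢ (sᵢ - 1)) / [kᵢ] ^ sᵢ`, obtained by expanding
`(1 - q ^ kᵢ) ^ (-sᵢ)` in powers of `q ^ kᵢ`. -/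
def cont (q : ℝ) : (d : ℕ) → ℂ → (Fin d → ℂ) → ℂ
  | 0, _, _ => 1
  | d + 1, x, s => (1 - (q : ℂ)) ^ s 0 * ∑' b : ℕ, rcoef (s 0) b *
      (geom q (x + s 0 - 1 + b) * cont q d (x + s 0 - 1 + b) (Fin.tail s))

theorem norm_cpow_lt_one {w : ℂ} (hw : 0 < w.re) : ‖(q : ℂ) ^ w‖ < 1 := by
  rw [Complex.norm_cpow_eq_rpow_re_of_pos hq0]
  exact Real.rpow_lt_one hq0.le hq1 hw

theorem hasSum_geom {w : ℂ} (hw : 0 < w.re) :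
    HasSum (fun j : ℕ => (q : ℂ) ^ (((1 + j : ℕ) : ℂ) * w)) (geom q w) := by
  have h := (hasSum_geometric_of_norm_lt_one (norm_cpow_lt_one hq0 hq1 hw)).mul_left ((q : ℂ) ^ w)
  rw [geom, div_eq_mul_inv]
  have e (j : ℕ) : (q : ℂ) ^ (((1 + j : ℕ) : ℂ) * w) = (q : ℂ) ^ w * ((q : ℂ) ^ w) ^ j := by
    rw [← pow_succ', mul_comm, Complex.cpow_mul_nat, add_comm]
  simpa only [e] using h

/-- Expand the outermost factor binomially and interchange the sums: for fixed b, the sum over gaps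
is geometric, and the sum over tails is the same series with offset increased by b, covered by
induction. -/
theorem cont_eq_tsum {d : ℕ} {x : ℂ} {s : Fin d → ℂ} (h : Above d 0 x s) :
    cont q d x s = ∑' k, offsetTerm q d x k s := by
  induction d generalizing x with
  | zero => simp [cont, offsetTerm, head, term_zero]
  | succ d ih =>
    have hq := ofReal_q_ne_zero hq0
    set w := x + s 0 - 1 with hw
    set t := Fin.tail s
    -- Rows sum over b to the summand of depth d + 1, up to (1 - q)^(s 0); columns sum over tails
    -- and gaps to the b-th term of `cont`.
    let A : Index d × ℕ → ℕ → ℂ := fun p b => rcoef (s 0) b *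
      (offsetTerm q d (w + b) p.1 t * (q : ℂ) ^ (((1 + p.2 : ℕ) : ℂ) * (w + b)))
    have hA0 (p : Index d × ℕ) (b : ℕ) : A p b =
        (q : ℂ) ^ (((head p.1 + 1 + p.2 : ℕ) : ℂ) * w) * term q d p.1 t *
          (rcoef (s 0) b * ((q : ℂ) ^ (head p.1 + 1 + p.2)) ^ b) := by
      have e : (q : ℂ) ^ ((head p.1 : ℂ) * (w + b)) * (q : ℂ) ^ (((1 + p.2 : ℕ) : ℂ) * (w + b)) =
          (q : ℂ) ^ (((head p.1 + 1 + p.2 : ℕ) : ℂ) * w) * ((q : ℂ) ^ (head p.1 + 1 + p.2)) ^ b := by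
        rw [← Complex.cpow_add _ _ hq, ← pow_mul, ← Complex.cpow_natCast,
          ← Complex.cpow_add _ _ hq]
        congr 1
        push_cast
        ring
      simp only [A, offsetTerm]
      linear_combination (rcoef (s 0) b * term q d p.1 t) * e
    have hA1 (p : Index d × ℕ) : HasSum (A p) (((1 - (q : ℂ)) ^ s 0)⁻¹ *
        offsetTerm q (d + 1) x (indexEquiv d p) s) := by
      have hn : ‖(q : ℂ) ^ (head p.1 + 1 + p.2)‖ < 1 := by
        rw [norm_pow, Complex.norm_real, Real.norm_of_nonneg hq0.le]
        exact pow_lt_one₀ hq0.le hq1 (by omega)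
      have h1 := (hasSum_rcoef (s 0) hn).mul_left
        ((q : ℂ) ^ (((head p.1 + 1 + p.2 : ℕ) : ℂ) * w) * term q d p.1 t)
      simp only [← hA0] at h1
      have h3 : (1 - (q : ℂ)) ^ s 0 ≠ 0 := by
        rw [Complex.cpow_ne_zero_iff]; left
        exact_mod_cast (sub_pos.2 hq1).ne'
      have e : (q : ℂ) ^ (((head p.1 + 1 + p.2 : ℕ) : ℂ) * w) =
          (q : ℂ) ^ (((head p.1 + 1 + p.2 : ℕ) : ℂ) * x) *
            (q : ℂ) ^ (((head p.1 + 1 + p.2 : ℕ) : ℂ) * (s 0 - 1)) := by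
        rw [← Complex.cpow_add _ _ hq, hw]; congr 1; ring
      have e2 : ((1 - (q : ℂ)) ^ s 0)⁻¹ * offsetTerm q (d + 1) x (indexEquiv d p) s =
          (q : ℂ) ^ (((head p.1 + 1 + p.2 : ℕ) : ℂ) * w) * term q d p.1 t *
            (1 - (q : ℂ) ^ (head p.1 + 1 + p.2)) ^ (-s 0) := by
        rw [offsetTerm_indexEquiv, fac_eq hq0 hq1 (by omega), e]
        field_simp
        rfl
      rw [e2]
      exact h1
    have hw0 : 0 < w.re := h.1
    have hr : q ^ w.re < 1 := Real.rpow_lt_one hq0.le hq1 hw0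
    have hA2 : Summable (Function.uncurry A) := by
      have h1 := (summable_norm_offsetTerm hq0 hq1 h.2).mul_of_nonneg
        (summable_geometric_of_lt_one (Real.rpow_pos_of_pos hq0 _).le hr)
        (fun _ => norm_nonneg _) (fun _ => by positivity)
      have h2 := h1.mul_of_nonneg (summable_norm_rcoef_mul_pow ‖s 0‖ hq0.le hq1)
        (fun _ => by positivity) (fun _ => by positivity)
      refine h2.of_norm_bounded ?_
      rintro ⟨p, b⟩
      have e1 : ‖offsetTerm q d (w + b) p.1 t‖ ≤ ‖offsetTerm q d w p.1 t‖ := by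
        rw [offsetTerm, offsetTerm, norm_mul, norm_mul, Complex.norm_cpow_eq_rpow_re_of_pos hq0,
          Complex.norm_cpow_eq_rpow_re_of_pos hq0]
        gcongr ?_ * _
        refine Real.rpow_le_rpow_of_exponent_ge hq0 hq1.le ?_
        simp
        gcongr
        simp
      -- The exponent (1 + j)(Re w + b) is at least j Re w + b. This separates the gap j from b, so
      -- the majorant is a product of three summable families.
      have e2 : ‖(q : ℂ) ^ (((1 + p.2 : ℕ) : ℂ) * (w + b))‖ ≤ (q ^ w.re) ^ p.2 * q ^ b := by
        rw [Complex.norm_cpow_eq_rpow_re_of_pos hq0, ← Real.rpow_mul_natCast hq0.le,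
          ← Real.rpow_natCast q b, ← Real.rpow_add hq0]
        refine Real.rpow_le_rpow_of_exponent_ge hq0 hq1.le ?_
        have : (((1 + p.2 : ℕ) : ℂ) * (w + b)).re = (1 + p.2) * (w.re + b) := by
          simp
        rw [this]
        have : 0 ≤ (p.2 : ℝ) * b := by positivity
        nlinarith
      simp only [Function.uncurry, A, norm_mul]
      calc ‖rcoef (s 0) b‖ * (‖offsetTerm q d (w + b) p.1 t‖ *
            ‖(q : ℂ) ^ (((1 + p.2 : ℕ) : ℂ) * (w + b))‖)
          ≤ ‖rcoef (‖s 0‖ : ℂ) b‖ * (‖offsetTerm q d w p.1 t‖ * ((q ^ w.re) ^ p.2 * q ^ b)) := by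
            gcongr
            exact norm_rcoef_le le_rfl b
        _ = _ := by ring
    have h3 : (1 - (q : ℂ)) ^ s 0 ≠ 0 := by
      rw [Complex.cpow_ne_zero_iff]; left
      exact_mod_cast (sub_pos.2 hq1).ne'
    have hA3 (b : ℕ) : ∑' p, A p b = rcoef (s 0) b * (geom q (w + b) * cont q d (w + b) t) := by
      have hb : 0 < (w + b).re := by simp; positivity
      have hg := hasSum_geom hq0 hq1 hb
      have hT := summable_norm_offsetTerm hq0 hq1 (h.2.add_natCast b)
      rw [tsum_mul_left, ih (h.2.add_natCast b), ← hg.tsum_eq, mul_comm (∑' j : ℕ, _),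
        tsum_mul_tsum_of_summable_norm hT hg.summable.norm]
    rw [← (indexEquiv d).tsum_eq, cont]
    simp only [← hw]
    change _ * ∑' b : ℕ, rcoef (s 0) b * (geom q (w + b) * cont q d (w + b) t) = _
    simp only [← hA3]
    rw [hA2.tsum_comm]
    simp only [(hA1 _).tsum_eq]
    rw [tsum_mul_left, mul_inv_cancel_left₀ h3]

theorem cont_eq_zeta {d : ℕ} {s : Fin d → ℂ} (h : s ∈ domain d) :
    cont q d 0 s = zeta q d s := by
  simp only [cont_eq_tsum hq0 hq1 (mem_domain_iff.1 h), offsetTerm_zero_left, zeta]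

end

/-! ### Shifts of the first variable and bounds for the two series -/

/-- The point `(s₁ + a, s₂, …)`. -/
def headShift {d : ℕ} (s : Fin (d + 1) → ℂ) (a : ℂ) : Fin (d + 1) → ℂ :=
  Fin.cons (s 0 + a) (Fin.tail s)

theorem headShift_zero {d : ℕ} (s : Fin (d + 1) → ℂ) : headShift s 0 = s := by
  simp [headShift]

theorem headShift_headShift {d : ℕ} (s : Fin (d + 1) → ℂ) (a b : ℂ) :
    headShift (headShift s a) b = headShift s (a + b) := by
  simp [headShift, add_assoc]

theorem shift_eq_headShift {m : ℕ} (s : Fin (m + 2) → ℂ) (a : ℂ) : shift s a = headShift s a := rfl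

theorem merge_add {m : ℕ} (s : Fin (m + 2) → ℂ) (a b : ℂ) :
    merge s (a + b) = headShift (merge s a) b := by
  rw [headShift, merge, merge, Fin.tail_cons, Fin.cons_zero, add_assoc (s 0 + s 1)]

theorem continuous_headShift {d : ℕ} :
    Continuous fun p : (Fin (d + 1) → ℂ) × ℂ => headShift p.1 p.2 := by
  refine continuous_pi fun i => ?_
  refine Fin.cases ?_ (fun i => ?_) i
  · simp only [headShift, Fin.cons_zero]; fun_prop
  · simp only [headShift, Fin.cons_succ, Fin.tail]; fun_prop

theorem continuous_merge {m : ℕ} (a : ℂ) :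
    Continuous fun s : Fin (m + 2) → ℂ => merge s a := by
  refine continuous_pi fun i => ?_
  refine Fin.cases ?_ (fun i => ?_) i
  · simp only [merge, Fin.cons_zero]; fun_prop
  · simp only [merge, Fin.cons_succ]; fun_prop

theorem above_headShift {d : ℕ} {a : ℝ} {x y : ℂ} {s : Fin (d + 1) → ℂ} :
    Above (d + 1) a x (headShift s y) ↔ Above (d + 1) a (x + y) s := by
  have e : x + (s 0 + y) - 1 = x + y + s 0 - 1 := by ring
  simp only [Above, headShift, Fin.cons_zero, Fin.tail_cons, e]

/-- The partial sums of the merged tuple are those of the original with the first one omitted.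
Merging removes one subtraction of 1, whence the offset y + 1. -/
theorem Above.merge {m : ℕ} {a : ℝ} {x y : ℂ} {s : Fin (m + 2) → ℂ}
    (h : Above (m + 2) a (x + y + 1) s) : Above (m + 1) a x (merge s y) := by
  have e : x + (s 0 + s 1 + y) - 1 = x + y + 1 + s 0 - 1 + Fin.tail s 0 - 1 := by
    simp [Fin.tail]; ring
  have h2 := h.2
  simp only [Above] at h2 ⊢
  simp only [BZ.merge, Fin.cons_zero, e]
  exact h2

theorem merge_sub_one_mem_domain {m : ℕ} {s : Fin (m + 2) → ℂ} {y : ℂ}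
    (h : shift s y ∈ domain (m + 2)) : merge s (y - 1) ∈ domain (m + 1) := by
  rw [mem_domain_iff, shift_eq_headShift, above_headShift] at h
  rw [mem_domain_iff]
  exact Above.merge (by simpa using h)

theorem headShift_natCast_mem_domain {d : ℕ} {s : Fin (d + 1) → ℂ} (h : s ∈ domain (d + 1))
    (n : ℕ) : headShift s n ∈ domain (d + 1) := by
  rw [mem_domain_iff, above_headShift]
  exact (mem_domain_iff.1 h).add_natCast n

section

variable {q : ℝ} (hq0 : 0 < q) (hq1 : q < 1)

include hq0 hq1

theorem term_headShift {d : ℕ} (k : Index (d + 1)) (s : Fin (d + 1) → ℂ) (n : ℕ) :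
    term q (d + 1) k (headShift s n) = term q (d + 1) k s * (ratio q (k.1 0) : ℂ) ^ n := by
  obtain ⟨p, rfl⟩ := (indexEquiv d).surjective k
  rw [term_indexEquiv, term_indexEquiv, headShift, Fin.cons_zero, Fin.tail_cons,
    fac_add_natCast hq0 hq1 (by omega)]
  exact mul_right_comm _ _ _

theorem norm_ratio_le {n : ℕ} (hn : 1 ≤ n) : ‖(ratio q n : ℂ)‖ ≤ q := by
  rw [Complex.norm_real, Real.norm_of_nonneg (ratio_pos hq0 hq1 hn).le]
  exact ratio_le hq0 hq1 hn

/-- Shifting s₁ by n multiplies every summand by (q^k/[k])^n, with k the head, and this ratio is at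
most q. -/
theorem exists_norm_zeta_headShift_le {d : ℕ} {K : Set (Fin (d + 1) → ℂ)} (hK : IsCompact K)
    (h : K ⊆ domain (d + 1)) :
    ∃ C, 0 ≤ C ∧ ∀ s ∈ K, ∀ n : ℕ, ‖zeta q (d + 1) (headShift s n)‖ ≤ C * q ^ n := by
  obtain ⟨u, hu, hb⟩ := normallyConvergentOn_term hq0 hq1 hK h
  refine ⟨∑' k, |u k|, tsum_nonneg fun _ => abs_nonneg _, fun s hs n => ?_⟩
  rw [← tsum_mul_right]
  refine tsum_of_norm_bounded (hu.abs.mul_right _).hasSum fun k => ?_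
  rw [term_headShift hq0 hq1, norm_mul, norm_pow]
  gcongr
  · exact (hb k s hs).trans (le_abs_self _)
  · exact norm_ratio_le hq0 hq1 (k.2.2 0)

theorem summable_norm_rcoef_add (R : ℝ) (n : ℕ) :
    Summable fun k => ‖rcoef (R : ℂ) (k + n)‖ * q ^ k := by
  have h := ((summable_nat_add_iff n).2 (summable_norm_rcoef_mul_pow R hq0.le hq1)).mul_right
    ((q ^ n)⁻¹)
  refine h.congr fun k => ?_
  rw [pow_add]
  field_simp

/-- Geometric decay of the shifted values beats the growth of the binomial coefficients. Only terms
from index n on are bounded, so the points need only enter the domain after a shift by n; n = 0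
gives normal convergence on the domain itself, and large n serves the continuation. -/
theorem exists_summable_bound_leftTerm {m : ℕ} {G : (Fin (m + 1) → ℂ) → ℂ}
    (hG : Set.EqOn G (zeta q (m + 1)) (domain (m + 1)))
    {K : Set (Fin (m + 2) → ℂ)} (hK : IsCompact K) {n : ℕ}
    (h : ∀ s ∈ K, shift s n ∈ domain (m + 2)) :
    ∃ u : ℕ → ℝ, Summable u ∧ ∀ k, ∀ s ∈ K, ‖leftTerm q G (k + n) s‖ ≤ u k := by
  obtain ⟨R, hR⟩ := hK.isBounded.exists_norm_le
  obtain ⟨C, hC0, hC⟩ := exists_norm_zeta_headShift_le hq0 hq1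
    (hK.image (continuous_merge ((n : ℂ) - 1)))
    (Set.image_subset_iff.2 fun s hs => merge_sub_one_mem_domain (h s hs))
  -- The factor 2 accounts for the two values of G in each term, since |1 - q| ≤ 1.
  refine ⟨_, (summable_norm_rcoef_add hq0 hq1 R n).mul_right (2 * C), fun k s hs => ?_⟩
  have hd := merge_sub_one_mem_domain (h s hs)
  have e1 : merge s ((k + n : ℕ) : ℂ) = headShift (merge s ((n : ℂ) - 1)) ((k + 1 : ℕ) : ℂ) := by
    rw [← merge_add]; congr 1; push_cast; ring
  have e2 : merge s (((k + n : ℕ) : ℂ) - 1) = headShift (merge s ((n : ℂ) - 1)) (k : ℂ) := by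
    rw [← merge_add]; congr 1; push_cast; ring
  have h0 : ‖(1 - (q : ℂ))‖ ≤ 1 := by
    have : (1 - (q : ℂ)) = ((1 - q : ℝ) : ℂ) := by push_cast; rfl
    rw [this, Complex.norm_real, Real.norm_of_nonneg (by linarith)]; linarith
  have b1 := hC _ (Set.mem_image_of_mem _ hs) (k + 1)
  have b2 := hC _ (Set.mem_image_of_mem _ hs) k
  rw [leftTerm, e1, e2, hG (headShift_natCast_mem_domain hd _),
    hG (headShift_natCast_mem_domain hd _), norm_mul, norm_mul, norm_pow, norm_neg, norm_one,
    one_pow, one_mul]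
  have b3 : C * q ^ (k + 1) ≤ C * q ^ k := by
    gcongr ?_ * ?_
    exact pow_le_pow_of_le_one hq0.le hq1.le (Nat.le_succ k)
  calc _ ≤ ‖rcoef (R : ℂ) (k + n)‖ * (C * q ^ k + 1 * (C * q ^ k)) := by
        gcongr
        · exact norm_rcoef_le ((norm_le_pi_norm s 0).trans (hR s hs)) _
        · refine (norm_add_le _ _).trans ?_
          rw [norm_mul]
          gcongr
          exact b1.trans b3
    _ = _ := by ring

theorem exists_summable_bound_rightTerm {m : ℕ} {F : (Fin (m + 2) → ℂ) → ℂ}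
    (hF : Set.EqOn F (zeta q (m + 2)) (domain (m + 2)))
    {K : Set (Fin (m + 2) → ℂ)} (hK : IsCompact K) {n : ℕ}
    (h : ∀ s ∈ K, shift s n ∈ domain (m + 2)) :
    ∃ u : ℕ → ℝ, Summable u ∧ ∀ k, ∀ s ∈ K, ‖rightTerm F (k + n) s‖ ≤ u k := by
  obtain ⟨R, hR⟩ := hK.isBounded.exists_norm_le
  obtain ⟨C, hC0, hC⟩ := exists_norm_zeta_headShift_le hq0 hq1
    (hK.image (f := fun s => headShift s (n : ℂ))
      (continuous_headShift.comp (continuous_id.prodMk continuous_const)))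
    (Set.image_subset_iff.2 fun s hs => h s hs)
  refine ⟨_, (summable_norm_rcoef_add hq0 hq1 R (n + 1)).mul_right C, fun k s hs => ?_⟩
  have hd : headShift s n ∈ domain (m + 2) := h s hs
  have e1 : shift s (((k + n : ℕ) : ℂ) + 1) = headShift (headShift s (n : ℂ)) ((k + 1 : ℕ) : ℂ) := by
    rw [headShift_headShift, shift_eq_headShift]; congr 1; push_cast; ring
  have b1 := hC _ (Set.mem_image_of_mem _ hs) (k + 1)
  rw [rightTerm, e1, hF (headShift_natCast_mem_domain hd _), norm_mul, norm_mul, norm_pow,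
    norm_neg, norm_one, one_pow, one_mul]
  have b3 : C * q ^ (k + 1) ≤ C * q ^ k := by
    gcongr ?_ * ?_
    exact pow_le_pow_of_le_one hq0.le hq1.le (Nat.le_succ k)
  calc _ ≤ ‖rcoef (R : ℂ) (k + n + 1)‖ * (C * q ^ k) := by
        gcongr
        · exact norm_rcoef_le ((norm_le_pi_norm s 0).trans (hR s hs)) _
        · exact b1.trans b3
    _ = _ := by rw [add_assoc]; ring

/-! ### The translation formula on the domain of the series -/

theorem hasSum_alternating {n : ℕ} (hn : 1 ≤ n) (s : ℂ) :
    HasSum (fun k : ℕ => (-1) ^ k * rcoef s k * (ratio q n : ℂ) ^ k)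
      ((1 + (ratio q n : ℂ)) ^ (-s)) := by
  have h := hasSum_rcoef s (x := -(ratio q n : ℂ))
    (by rw [norm_neg]; exact (norm_ratio_le hq0 hq1 hn).trans_lt hq1)
  rw [sub_neg_eq_add] at h
  have e (k : ℕ) : (-1) ^ k * rcoef s k * (ratio q n : ℂ) ^ k =
      rcoef s k * (-(ratio q n : ℂ)) ^ k := by
    rw [neg_pow (ratio q n : ℂ)]; ring
  simpa only [e] using h

theorem hasSum_alternating_succ {n : ℕ} (hn : 1 ≤ n) (s : ℂ) :
    HasSum (fun k : ℕ => (-1) ^ k * rcoef s (k + 1) * (ratio q n : ℂ) ^ (k + 1))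
      (1 - (1 + (ratio q n : ℂ)) ^ (-s)) := by
  have h := ((hasSum_nat_add_iff' 1).2 (hasSum_alternating hq0 hq1 hn s)).neg
  have e (k : ℕ) : (-1) ^ k * rcoef s (k + 1) * (ratio q n : ℂ) ^ (k + 1) =
      -((-1) ^ (k + 1) * rcoef s (k + 1) * (ratio q n : ℂ) ^ (k + 1)) := by
    rw [pow_succ (-1 : ℂ)]; ring
  simp only [← e] at h
  simpa [rcoef_zero] using h

/-- Absolute summability of the double family justifies the interchange of sums: e = 0 is used for
the left side, e = 1 for the right side. -/
theorem summable_alternating_mul {ι : Type*} {c : ι → ℂ} (hc : Summable fun i => ‖c i‖)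
    (n : ι → ℕ) (hn : ∀ i, 1 ≤ n i) (s : ℂ) (e : ℕ) :
    Summable (Function.uncurry fun (k : ℕ) (i : ι) =>
      c i * ((-1) ^ k * rcoef s (k + e) * (ratio q (n i) : ℂ) ^ (k + e))) := by
  have h := ((summable_nat_add_iff e).2
    (summable_norm_rcoef_mul_pow ‖s‖ hq0.le hq1)).mul_of_nonneg hc
    (fun _ => by positivity) (fun _ => norm_nonneg _)
  refine h.of_norm_bounded ?_
  rintro ⟨k, i⟩
  simp only [Function.uncurry, norm_mul, norm_pow, norm_neg, norm_one, one_pow, one_mul]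
  rw [mul_comm]
  gcongr
  · exact norm_rcoef_le le_rfl _
  · exact norm_ratio_le hq0 hq1 (hn i)

/-- The product rule for factors splits the merged entry back into exponents s₁ + k and s₂ at the
same index. Summing over k then gives a power of 1 + q^n/[n], which raises the index of the first
factor by one. -/
theorem tsum_leftTerm_zeta {m : ℕ} {s : Fin (m + 2) → ℂ} (hs : s ∈ domain (m + 2)) :
    ∑' k : ℕ, leftTerm q (zeta q (m + 1)) k s =
      ∑' k : Index (m + 1), (q : ℂ) ^ (1 - s 0) * fac q (head k + 1) (s 0) *
        term q (m + 1) k (Fin.tail s) := by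
  have hd : merge s (-1) ∈ domain (m + 1) := by
    have := merge_sub_one_mem_domain (s := s) (y := 0)
      (by rwa [shift_eq_headShift, headShift_zero])
    simpa using this
  have h1 (k : Index (m + 1)) (n : ℕ) : term q (m + 1) k (merge s n) +
      (1 - (q : ℂ)) * term q (m + 1) k (merge s ((n : ℂ) - 1)) =
      fac q (head k) (s 0) * term q (m + 1) k (Fin.tail s) * (ratio q (head k) : ℂ) ^ n := by
    have hk : 1 ≤ head k := k.2.2 0
    have h2 := fac_mul_fac hq0 hq1 hk (s 0 + n) (s 1)
    rw [fac_add_natCast hq0 hq1 hk] at h2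
    obtain ⟨p, rfl⟩ := (indexEquiv m).surjective k
    rw [term_indexEquiv, term_indexEquiv, term_indexEquiv]
    rw [head_indexEquiv] at h2 ⊢
    have e1 : (merge s n : Fin (m + 1) → ℂ) 0 = s 0 + n + s 1 := by simp [merge]; ring
    have e2 : (merge s ((n : ℂ) - 1) : Fin (m + 1) → ℂ) 0 = s 0 + n + s 1 - 1 := by
      simp [merge]; ring
    have e3 (a : ℂ) : Fin.tail (merge s a) = Fin.tail (Fin.tail s) := rfl
    have e4 : Fin.tail s 0 = s 1 := rfl
    rw [e1, e2, e3, e3, e4]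
    linear_combination -term q m p.1 (Fin.tail (Fin.tail s)) * h2
  have hd' (n : ℕ) : merge s n ∈ domain (m + 1) := by
    have := headShift_natCast_mem_domain hd (n + 1)
    rw [← merge_add] at this
    simpa using this
  have hd'' (n : ℕ) : merge s ((n : ℂ) - 1) ∈ domain (m + 1) := by
    have := headShift_natCast_mem_domain hd n
    rw [← merge_add] at this
    rwa [sub_eq_neg_add]
  have hsum (n : ℕ) := (summable_norm_term hq0 hq1 (hd' n)).of_norm
  have hsum' (n : ℕ) := ((summable_norm_term hq0 hq1 (hd'' n)).of_norm).mul_left (1 - (q : ℂ))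
  -- The tail of s need not lie in the domain of depth m + 1. Summability is read off from the
  -- merged series at n = 0 instead.
  have hc : Summable fun k : Index (m + 1) =>
      ‖fac q (head k) (s 0) * term q (m + 1) k (Fin.tail s)‖ := by
    have := (hsum 0).add (hsum' 0)
    simp only [h1, pow_zero, mul_one] at this
    exact this.norm
  have h3 (k : ℕ) : leftTerm q (zeta q (m + 1)) k s = ∑' i : Index (m + 1),
      fac q (head i) (s 0) * term q (m + 1) i (Fin.tail s) *
        ((-1) ^ k * rcoef (s 0) (k + 0) * (ratio q (head i) : ℂ) ^ (k + 0)) := by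
    rw [leftTerm, zeta, zeta, ← tsum_mul_left (a := 1 - (q : ℂ)), ← (hsum k).tsum_add (hsum' k),
      ← tsum_mul_left]
    refine tsum_congr fun i => ?_
    rw [h1, rcoef, add_zero]
    ring
  simp only [h3]
  rw [← (summable_alternating_mul hq0 hq1 hc head (fun k => k.2.2 0) (s 0) 0).tsum_comm]
  refine tsum_congr fun i => ?_
  have hi : 1 ≤ head i := i.2.2 0
  rw [tsum_mul_left]
  simp only [add_zero]
  rw [(hasSum_alternating hq0 hq1 hi (s 0)).tsum_eq, mul_right_comm,
    fac_mul_one_add_ratio_cpow hq0 hq1 hi]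

/-- Here the sum over k omits the constant term of the binomial series. Adding the boundary term
leaves q^(1 - s₁) times a difference of consecutive first factors, and the sum over the gap
telescopes. -/
theorem tsum_rightTerm_zeta {m : ℕ} {s : Fin (m + 2) → ℂ} (hs : s ∈ domain (m + 2)) :
    ∑' k : ℕ, rightTerm (zeta q (m + 2)) k s + ((q : ℂ) ^ (1 - s 0) - 1) * zeta q (m + 2) s =
      ∑' k : Index (m + 1), (q : ℂ) ^ (1 - s 0) * fac q (head k + 1) (s 0) *
        term q (m + 1) k (Fin.tail s) := by
  have hc := summable_norm_term hq0 hq1 hs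
  have h3 (k : ℕ) : rightTerm (zeta q (m + 2)) k s = ∑' i : Index (m + 2),
      term q (m + 2) i s *
        ((-1) ^ k * rcoef (s 0) (k + 1) * (ratio q (head i) : ℂ) ^ (k + 1)) := by
    have e : shift s ((k : ℂ) + 1) = headShift s ((k + 1 : ℕ) : ℂ) := by
      rw [shift_eq_headShift]; push_cast; rfl
    rw [rightTerm, zeta, ← tsum_mul_left]
    refine tsum_congr fun i => ?_
    rw [e, term_headShift hq0 hq1, rcoef]
    simp only [head]
    ring
  have h4 := summable_alternating_mul hq0 hq1 hc head (fun k => k.2.2 0) (s 0) 1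
  have h5 (i : Index (m + 2)) : ∑' k : ℕ, term q (m + 2) i s *
      ((-1) ^ k * rcoef (s 0) (k + 1) * (ratio q (head i) : ℂ) ^ (k + 1)) =
      term q (m + 2) i s * (1 - (1 + (ratio q (head i) : ℂ)) ^ (-s 0)) := by
    rw [tsum_mul_left, (hasSum_alternating_succ hq0 hq1 (show 1 ≤ head i from i.2.2 0) (s 0)).tsum_eq]
  have h6 : Summable fun i : Index (m + 2) =>
      term q (m + 2) i s * (1 - (1 + (ratio q (head i) : ℂ)) ^ (-s 0)) := by
    simp only [← h5]
    exact h4.prod_symm.prod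
  simp only [h3]
  rw [← h4.tsum_comm]
  simp only [h5]
  rw [zeta, ← tsum_mul_left, ← h6.tsum_add (hc.of_norm.mul_left _)]
  have hp : Summable fun p : Index (m + 1) × ℕ =>
      fac q (head p.1 + 1 + p.2) (s 0) * term q (m + 1) p.1 (Fin.tail s) := by
    have h := ((indexEquiv (m + 1)).summable_iff (f := fun i => term q (m + 2) i s)).2 hc.of_norm
    refine h.congr fun p => (term_indexEquiv q p s)
  rw [← (indexEquiv (m + 1)).tsum_eq]
  have h7 (p : Index (m + 1) × ℕ) : term q (m + 2) (indexEquiv (m + 1) p) s *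
      (1 - (1 + (ratio q (head (indexEquiv (m + 1) p)) : ℂ)) ^ (-s 0)) +
      ((q : ℂ) ^ (1 - s 0) - 1) * term q (m + 2) (indexEquiv (m + 1) p) s =
      (q : ℂ) ^ (1 - s 0) * (fac q (head p.1 + 1 + p.2) (s 0) *
        term q (m + 1) p.1 (Fin.tail s) - fac q (head p.1 + 1 + (p.2 + 1)) (s 0) *
        term q (m + 1) p.1 (Fin.tail s)) := by
    have h8 := fac_mul_one_add_ratio_cpow hq0 hq1 (n := head p.1 + 1 + p.2) (by omega) (s 0)
    rw [term_indexEquiv, head_indexEquiv, ← add_assoc]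
    linear_combination -term q (m + 1) p.1 (Fin.tail s) * h8
  simp only [h7]
  have hp1 (k : Index (m + 1)) : Summable fun j : ℕ =>
      fac q (head k + 1 + j) (s 0) * term q (m + 1) k (Fin.tail s) := hp.prod_factor k
  have hp2 : Summable fun p : Index (m + 1) × ℕ =>
      fac q (head p.1 + 1 + (p.2 + 1)) (s 0) * term q (m + 1) p.1 (Fin.tail s) :=
    hp.comp_injective (i := fun p : Index (m + 1) × ℕ => (p.1, p.2 + 1)) (by
      rintro ⟨a, b⟩ ⟨c, e⟩ h
      simpa using h)
  rw [((hp.sub hp2).mul_left _).tsum_prod]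
  refine tsum_congr fun k => ?_
  have hp3 := (summable_nat_add_iff 1).2 (hp1 k)
  rw [tsum_mul_left, (hp1 k).tsum_sub hp3, (hp1 k).tsum_eq_zero_add, add_sub_cancel_right,
    -- What survives is the term with gap 0, that is, first index equal to the head of the tail plus
    -- 1.
    add_zero, mul_assoc]

theorem translationFormula_of_mem_domain {m : ℕ} {G : (Fin (m + 1) → ℂ) → ℂ}
    {F : (Fin (m + 2) → ℂ) → ℂ} (hG : Set.EqOn G (zeta q (m + 1)) (domain (m + 1)))
    (hF : Set.EqOn F (zeta q (m + 2)) (domain (m + 2))) {s : Fin (m + 2) → ℂ}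
    (hs : s ∈ domain (m + 2)) : TranslationFormula q G F s := by
  have hs0 : ∀ t ∈ ({s} : Set (Fin (m + 2) → ℂ)), shift t ((0 : ℕ) : ℂ) ∈ domain (m + 2) := by
    rintro t rfl
    rwa [Nat.cast_zero, shift_eq_headShift, headShift_zero]
  obtain ⟨u, hu, hbu⟩ := exists_summable_bound_leftTerm hq0 hq1 hG isCompact_singleton hs0
  obtain ⟨v, hv, hbv⟩ := exists_summable_bound_rightTerm hq0 hq1 hF isCompact_singleton hs0
  refine ⟨hu.of_norm_bounded fun k => hbu k s rfl, hv.of_norm_bounded fun k => hbv k s rfl, ?_⟩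
  have hd : merge s (-1) ∈ domain (m + 1) := by
    have := merge_sub_one_mem_domain (s := s) (y := 0)
      (by rwa [shift_eq_headShift, headShift_zero])
    simpa using this
  have e1 (k : ℕ) : leftTerm q G k s = leftTerm q (zeta q (m + 1)) k s := by
    have h1 := headShift_natCast_mem_domain hd (k + 1)
    have h2 := headShift_natCast_mem_domain hd k
    rw [← merge_add] at h1 h2
    have e : (-1 : ℂ) + ((k + 1 : ℕ) : ℂ) = k := by push_cast; ring
    have e' : (-1 : ℂ) + (k : ℂ) = k - 1 := by ring
    rw [e] at h1
    rw [e'] at h2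
    rw [leftTerm, leftTerm, hG h1, hG h2]
  have e2 (k : ℕ) : rightTerm F k s = rightTerm (zeta q (m + 2)) k s := by
    have h1 := headShift_natCast_mem_domain hs (k + 1)
    rw [Nat.cast_add, Nat.cast_one] at h1
    rw [rightTerm, rightTerm, shift_eq_headShift, hF h1]
  simp only [e1, e2]
  rw [tsum_leftTerm_zeta hq0 hq1 hs, ← tsum_rightTerm_zeta hq0 hq1 hs, hF hs, neg_sub]

end

/-! ### Holomorphic operators on bounded sequences -/

open scoped BoundedContinuousFunction

section Operators

/-- The unit vector of `ℕ →ᵇ ℂ` at `n`. -/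
def unitVec (n : ℕ) : ℕ →ᵇ ℂ :=
  BoundedContinuousFunction.ofNormedAddCommGroupDiscrete (Pi.single n 1) 1 fun m => by
    by_cases h : m = n
    · subst h; simp
    · simp [h]

theorem unitVec_apply (n m : ℕ) : unitVec n m = if m = n then 1 else 0 := by
  simp [unitVec, Pi.single_apply]

theorem norm_unitVec_le (n : ℕ) : ‖unitVec n‖ ≤ 1 := by
  refine (BoundedContinuousFunction.norm_le zero_le_one).2 fun m => ?_
  rw [unitVec_apply]; split_ifs <;> simp

/-- The left shift on `ℕ →ᵇ ℂ`. -/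
def leftShift : (ℕ →ᵇ ℂ) →L[ℂ] (ℕ →ᵇ ℂ) :=
  LinearMap.mkContinuous
    { toFun := fun f => f.compContinuous ⟨fun n => n + 1, continuous_of_discreteTopology⟩
      map_add' := fun _ _ => rfl
      map_smul' := fun _ _ => rfl } 1 fun f => by
    rw [one_mul]
    exact (BoundedContinuousFunction.norm_le (norm_nonneg _)).2 fun n => f.norm_coe_le_norm (n + 1)

theorem leftShift_pow_apply (b : ℕ) (f : ℕ →ᵇ ℂ) (n : ℕ) : (leftShift ^ b) f n = f (n + b) := by
  induction b generalizing n with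
  | zero => rfl
  | succ b ih =>
    rw [pow_succ']
    exact (ih (n + 1)).trans (congrArg f (by omega))

theorem norm_leftShift_pow_le (b : ℕ) : ‖leftShift ^ b‖ ≤ 1 :=
  ContinuousLinearMap.opNorm_le_bound _ zero_le_one fun f => by
    rw [one_mul]
    refine (BoundedContinuousFunction.norm_le (norm_nonneg _)).2 fun n => ?_
    rw [leftShift_pow_apply]
    exact f.norm_coe_le_norm _

/-- The sequence of powers of `r`. -/
def powVec (r : ℝ) (h0 : 0 ≤ r) (h1 : r ≤ 1) : ℕ →ᵇ ℂ :=
  BoundedContinuousFunction.ofNormedAddCommGroupDiscrete (fun n => (r : ℂ) ^ n) 1 fun n => by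
    rw [norm_pow, Complex.norm_real, Real.norm_of_nonneg h0]
    exact pow_le_one₀ h0 h1

/-- The operator `∑ b, (s)_b / b! r ^ b S ^ b`, where `S` is the left shift. -/
def binomOp (r : ℝ) (s : ℂ) : (ℕ →ᵇ ℂ) →L[ℂ] (ℕ →ᵇ ℂ) :=
  ∑' b : ℕ, (rcoef s b * (r : ℂ) ^ b) • leftShift ^ b

variable {r : ℝ} (h0 : 0 ≤ r) (h1 : r < 1)

include h0 in
theorem norm_binomOp_term_le {s : ℂ} {R : ℝ} (hs : ‖s‖ ≤ R) (b : ℕ) :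
    ‖(rcoef s b * (r : ℂ) ^ b) • leftShift ^ b‖ ≤ ‖rcoef (R : ℂ) b‖ * r ^ b := by
  rw [norm_smul, norm_mul, norm_pow, Complex.norm_real, Real.norm_of_nonneg h0]
  have h2 := norm_rcoef_le hs b
  have h3 := norm_leftShift_pow_le b
  calc _ ≤ ‖rcoef (R : ℂ) b‖ * r ^ b * 1 := by gcongr
    _ = _ := mul_one _

include h0 h1

theorem binomOp_apply (s : ℂ) (f : ℕ →ᵇ ℂ) (n : ℕ) :
    binomOp r s f n = ∑' b : ℕ, rcoef s b * (r : ℂ) ^ b * f (n + b) := by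
  have hs : Summable fun b : ℕ => (rcoef s b * (r : ℂ) ^ b) • leftShift ^ b :=
    (summable_norm_rcoef_mul_pow ‖s‖ h0 h1).of_norm_bounded (norm_binomOp_term_le h0 le_rfl)
  have h := hs.hasSum.mapL ((BoundedContinuousFunction.evalCLM ℂ n).comp
    (ContinuousLinearMap.apply ℂ (ℕ →ᵇ ℂ) f))
  refine h.tsum_eq.symm.trans (tsum_congr fun b => ?_)
  show rcoef s b * (r : ℂ) ^ b * (leftShift ^ b) f n = _
  rw [leftShift_pow_apply]

omit h0 h1 in
theorem differentiable_rcoef (b : ℕ) : Differentiable ℂ fun s => rcoef s b := by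
  unfold rcoef rising
  refine Differentiable.div_const ?_ _
  fun_prop

/-- The shift powers have norm at most 1, so the operator series is dominated on a ball by a
binomial series with real parameter ‖s‖ + 1. Locally uniform convergence preserves holomorphy. -/
theorem analyticAt_binomOp (s : ℂ) : AnalyticAt ℂ (binomOp r) s := by
  have ho : IsOpen (Metric.ball (0 : ℂ) (‖s‖ + 1)) := Metric.isOpen_ball
  have hd : DifferentiableOn ℂ (binomOp r) (Metric.ball (0 : ℂ) (‖s‖ + 1)) := by
    refine Complex.differentiableOn_tsum_of_summable_norm (E := (ℕ →ᵇ ℂ) →L[ℂ] (ℕ →ᵇ ℂ))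
      (F := fun b s => (rcoef s b * (r : ℂ) ^ b) • leftShift ^ b) (summable_norm_rcoef_mul_pow (‖s‖ + 1) h0 h1) (fun b => ?_) ho fun b w hw => ?_
    · have h2 : Differentiable ℂ fun s => rcoef s b * (r : ℂ) ^ b :=
        (differentiable_rcoef b).mul_const _
      exact (h2.smul_const (leftShift ^ b)).differentiableOn
    · exact norm_binomOp_term_le h0 (mem_ball_zero_iff.1 hw).le b
  exact hd.analyticAt (ho.mem_nhds (by simp))

omit h0 h1 in
theorem analyticAt_apply (z : ((ℕ →ᵇ ℂ) →L[ℂ] (ℕ →ᵇ ℂ)) × (ℕ →ᵇ ℂ)) :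
    AnalyticAt ℂ (fun z : ((ℕ →ᵇ ℂ) →L[ℂ] (ℕ →ᵇ ℂ)) × (ℕ →ᵇ ℂ) => z.1 z.2) z :=
  (ContinuousLinearMap.id ℂ ((ℕ →ᵇ ℂ) →L[ℂ] (ℕ →ᵇ ℂ))).analyticAt_bilinear z

end Operators

/-! ### Cancelling the poles of the geometric factors -/

section

variable {q : ℝ} (hq0 : 0 < q) (hq1 : q < 1)

/-- A holomorphic function that cancels the poles of `geom q (w + M)` for `M < N`. -/
def den (q : ℝ) (N : ℕ) (w : ℂ) : ℂ := ∏ L ∈ Finset.range N, (1 - (q : ℂ) ^ (w + L))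

/-- The function `den q N w * geom q (w + M)` with removable singularities removed. -/
def weight (q : ℝ) (N M : ℕ) (w : ℂ) : ℂ :=
  if M < N then (q : ℂ) ^ (w + M) * ∏ L ∈ (Finset.range N).erase M, (1 - (q : ℂ) ^ (w + L))
  else (q : ℂ) ^ (w + M) * den q N w / (1 - (q : ℂ) ^ (w + M))

theorem weight_eq {N M : ℕ} {w : ℂ} (h : (q : ℂ) ^ (w + M) ≠ 1) :
    weight q N M w = den q N w * geom q (w + M) := by
  have h' : 1 - (q : ℂ) ^ (w + M) ≠ 0 := sub_ne_zero.2 h.symm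
  rw [weight, geom]
  split_ifs with hM
  · rw [den, ← Finset.mul_prod_erase _ _ (Finset.mem_range.2 hM)]
    field_simp
  · ring

include hq0 in
theorem differentiable_one_sub_cpow (L : ℕ) :
    Differentiable ℂ fun w : ℂ => (1 - (q : ℂ) ^ (w + L)) := by
  have h : (fun w : ℂ => (1 - (q : ℂ) ^ (w + L))) =
      fun w => 1 - Complex.exp (Complex.log q * (w + L)) := by
    funext w; rw [Complex.cpow_def_of_ne_zero (ofReal_q_ne_zero hq0)]
  rw [h]
  fun_prop

include hq0 in
theorem differentiable_den (N : ℕ) : Differentiable ℂ (den q N) := by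
  have := differentiable_one_sub_cpow hq0
  unfold den
  fun_prop

include hq0 hq1

omit hq1 in
theorem norm_cpow_add_natCast (w : ℂ) (M : ℕ) : ‖(q : ℂ) ^ (w + M)‖ = q ^ w.re * q ^ M := by
  rw [Complex.norm_cpow_eq_rpow_re_of_pos hq0, ← Real.rpow_natCast, ← Real.rpow_add hq0]
  simp

theorem cpow_add_natCast_ne_one {w : ℂ} {N M : ℕ} (hw : -(N : ℝ) < w.re) (hM : N ≤ M) :
    (q : ℂ) ^ (w + M) ≠ 1 := by
  intro h
  have : 0 < (w + M).re := by
    have : (N : ℝ) ≤ M := by exact_mod_cast hM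
    simp; linarith
  have := norm_cpow_lt_one hq0 hq1 this
  rw [h] at this
  simp at this

theorem differentiableOn_weight (N M : ℕ) :
    DifferentiableOn ℂ (weight q N M) {w | -(N : ℝ) < w.re} := by
  have h1 (L : ℕ) := differentiable_one_sub_cpow hq0 L
  have h2 : Differentiable ℂ fun w : ℂ => (q : ℂ) ^ (w + M) := by
    have := (h1 M).const_sub 1
    simpa using this
  unfold weight
  split_ifs with hM
  · exact (by fun_prop : Differentiable ℂ _).differentiableOn
  · refine (h2.mul (differentiable_den hq0 N)).differentiableOn.div (h1 M).differentiableOn ?_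
    intro w hw
    exact sub_ne_zero.2 (cpow_add_natCast_ne_one hq0 hq1 hw (not_lt.1 hM)).symm

/-- For M < N there is no denominator. For M ≥ N the real part of w + M exceeds ε, which keeps the
denominator away from zero. The factor q^M comes from the numerator q^(w+M). -/
theorem exists_norm_weight_le (N : ℕ) {ε : ℝ} (hε : 0 < ε) :
    ∃ C, 0 ≤ C ∧ ∀ w : ℂ, -(N : ℝ) + ε < w.re → ∀ M, ‖weight q N M w‖ ≤ C * q ^ M := by
  -- `Q` bounds |q^w|, `B` bounds each factor 1 - q^(w+L), and `η` bounds the remaining denominator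
  -- from below.
  set Q := q ^ (-(N : ℝ)) with hQ
  have hQ0 : 0 < Q := Real.rpow_pos_of_pos hq0 _
  set B := 1 + Q with hB
  have hB1 : 1 ≤ B := by linarith
  set η := 1 - q ^ ε with hη
  have hη0 : 0 < η := sub_pos.2 (Real.rpow_lt_one hq0.le hq1 hε)
  have hη1 : 1 ≤ η⁻¹ := by
    rw [one_le_inv₀ hη0, hη]
    linarith [Real.rpow_pos_of_pos hq0 ε]
  refine ⟨Q * B ^ N * η⁻¹, by positivity, fun w hw M => ?_⟩
  have hw1 : q ^ w.re ≤ Q := Real.rpow_le_rpow_of_exponent_ge hq0 hq1.le (by linarith)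
  have hfac (L : ℕ) : ‖1 - (q : ℂ) ^ (w + L)‖ ≤ B := by
    refine (norm_sub_le _ _).trans ?_
    rw [norm_one, norm_cpow_add_natCast hq0, hB]
    gcongr
    exact (mul_le_of_le_one_right (by positivity) (pow_le_one₀ hq0.le hq1.le)).trans hw1
  have hprod (S : Finset ℕ) (hS : S.card ≤ N) : ‖∏ L ∈ S, (1 - (q : ℂ) ^ (w + L))‖ ≤ B ^ N := by
    rw [norm_prod]
    refine (Finset.prod_le_prod (fun _ _ => norm_nonneg _) fun L _ => hfac L).trans ?_
    rw [Finset.prod_const]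
    exact pow_le_pow_right₀ hB1 hS
  rw [weight]
  split_ifs with hM
  · rw [norm_mul, norm_cpow_add_natCast hq0]
    have h2 := hprod ((Finset.range N).erase M) ((Finset.card_erase_le).trans (by simp))
    calc q ^ w.re * q ^ M * _ ≤ Q * q ^ M * B ^ N := by gcongr
      _ = Q * B ^ N * 1 * q ^ M := by ring
      _ ≤ _ := by gcongr
  · have h2 : ‖den q N w‖ ≤ B ^ N := hprod _ (by simp)
    have h3 : η ≤ ‖1 - (q : ℂ) ^ (w + M)‖ := by
      have h4 := norm_sub_norm_le 1 ((q : ℂ) ^ (w + M))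
      rw [norm_one, Complex.norm_cpow_eq_rpow_re_of_pos hq0] at h4
      refine le_trans ?_ h4
      have h5 : (N : ℝ) ≤ M := by exact_mod_cast not_lt.1 hM
      have h6 : q ^ (w + M).re ≤ q ^ ε :=
        Real.rpow_le_rpow_of_exponent_ge hq0 hq1.le (by simp; linarith)
      linarith
    rw [norm_div, norm_mul, norm_cpow_add_natCast hq0, div_eq_mul_inv]
    calc q ^ w.re * q ^ M * ‖den q N w‖ * ‖1 - (q : ℂ) ^ (w + M)‖⁻¹
        ≤ Q * q ^ M * B ^ N * η⁻¹ := by gcongr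
      _ = _ := by ring

omit hq0 hq1 in
/-- The sequence `weight q N M w / √q ^ M`. -/
def weightVec (q : ℝ) (N : ℕ) (w : ℂ) : ℕ →ᵇ ℂ :=
  ∑' M : ℕ, (weight q N M w * ((√q : ℂ) ^ M)⁻¹) • unitVec M

theorem sqrt_pos_and_lt_one : 0 < √q ∧ √q < 1 :=
  ⟨Real.sqrt_pos.2 hq0, by rw [Real.sqrt_lt' one_pos]; simpa using hq1⟩

/-- The decay q^M is split into two halves √q^M: one makes this series of sequences converge in sup
norm, the other is reserved for the convergence of `binomOp √q`. -/
theorem norm_weightVec_term_le {N M : ℕ} {w : ℂ} {C : ℝ} (h : ‖weight q N M w‖ ≤ C * q ^ M) :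
    ‖(weight q N M w * ((√q : ℂ) ^ M)⁻¹) • unitVec M‖ ≤ C * √q ^ M := by
  have hr := (sqrt_pos_and_lt_one hq0 hq1).1
  rw [norm_smul, norm_mul, norm_inv, norm_pow, Complex.norm_real, Real.norm_of_nonneg hr.le]
  have h2 := norm_unitVec_le M
  have h3 : q ^ M = √q ^ M * √q ^ M := by rw [← mul_pow, Real.mul_self_sqrt hq0.le]
  have h4 : 0 ≤ C * q ^ M := (norm_nonneg _).trans h
  calc _ ≤ C * q ^ M * (√q ^ M)⁻¹ * 1 := by gcongr
    _ = _ := by rw [h3]; field_simp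

theorem weightVec_apply {N : ℕ} {w : ℂ} (hw : -(N : ℝ) < w.re) (L : ℕ) :
    weightVec q N w L = weight q N L w * ((√q : ℂ) ^ L)⁻¹ := by
  obtain ⟨ε, hε, hw'⟩ : ∃ ε > 0, -(N : ℝ) + ε < w.re := ⟨(w.re + N) / 2, by linarith, by linarith⟩
  obtain ⟨C, -, hC⟩ := exists_norm_weight_le hq0 hq1 N hε
  have hr := sqrt_pos_and_lt_one hq0 hq1
  have hs : Summable fun M : ℕ => (weight q N M w * ((√q : ℂ) ^ M)⁻¹) • unitVec M :=
    ((summable_geometric_of_lt_one hr.1.le hr.2).mul_left C).of_norm_bounded fun M =>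
      norm_weightVec_term_le hq0 hq1 (hC w hw' M)
  have h := hs.hasSum.mapL (BoundedContinuousFunction.evalCLM ℂ L)
  refine h.tsum_eq.symm.trans ?_
  rw [tsum_eq_single L]
  · simp [unitVec_apply]
  · intro M hM
    simp [unitVec_apply, hM.symm]

theorem analyticAt_weightVec {N : ℕ} {w : ℂ} (hw : -(N : ℝ) < w.re) :
    AnalyticAt ℂ (weightVec q N) w := by
  obtain ⟨ε, hε, hw'⟩ : ∃ ε > 0, -(N : ℝ) + ε < w.re := ⟨(w.re + N) / 2, by linarith, by linarith⟩
  obtain ⟨C, -, hC⟩ := exists_norm_weight_le hq0 hq1 N hε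
  have hr := sqrt_pos_and_lt_one hq0 hq1
  have ho : IsOpen {w : ℂ | -(N : ℝ) + ε < w.re} := isOpen_lt continuous_const Complex.continuous_re
  have hd : DifferentiableOn ℂ (weightVec q N) {w : ℂ | -(N : ℝ) + ε < w.re} := by
    refine Complex.differentiableOn_tsum_of_summable_norm
      ((summable_geometric_of_lt_one hr.1.le hr.2).mul_left C) (fun M => ?_) ho fun M w hw => ?_
    · have := (differentiableOn_weight hq0 hq1 N M).mono
        (fun w (hw : -(N : ℝ) + ε < w.re) => show -(N : ℝ) < w.re by linarith)
      exact (this.mul_const _).smul_const _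
    · exact norm_weightVec_term_le hq0 hq1 (hC w hw M)
  exact hd.analyticAt (ho.mem_nhds hw')

/-! ### Local numerators and denominators, and the regular set -/

omit hq0 hq1 in
/-- The point `x + ∑ (sᵢ - 1)` avoids, for all partial sums, the poles of `geom`. -/
def Reg (q : ℝ) : (d : ℕ) → ℂ → (Fin d → ℂ) → Prop
  | 0, _, _ => True
  | d + 1, x, s => (∀ L : ℕ, (q : ℂ) ^ (x + s 0 - 1 + L) ≠ 1) ∧
      Reg q d (x + s 0 - 1) (Fin.tail s)

omit hq0 hq1 in
/-- A common denominator of the terms of `cont` near a point. -/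
def denom (q : ℝ) (N : ℕ) : (d : ℕ) → ℂ → (Fin d → ℂ) → ℂ
  | 0, _, _ => 1
  | d + 1, x, s => den q N (x + s 0 - 1) * denom q N d (x + s 0 - 1) (Fin.tail s)

/-- The sequence `denom q N d x s * cont q d (x + L) s`, extended holomorphically. -/
def numer (N : ℕ) : (d : ℕ) → ℂ → (Fin d → ℂ) → ℕ →ᵇ ℂ
  | 0, _, _ => 1
  | d + 1, x, s => (1 - (q : ℂ)) ^ s 0 •
      (powVec √q (sqrt_pos_and_lt_one hq0 hq1).1.le (sqrt_pos_and_lt_one hq0 hq1).2.le *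
        binomOp √q (s 0) (weightVec q N (x + s 0 - 1) *
          numer N d (x + s 0 - 1) (Fin.tail s)))

omit hq0 hq1 in
theorem analyticAt_stepMap (d : ℕ) (p : ℂ × (Fin (d + 1) → ℂ)) : AnalyticAt ℂ (stepMap d) p := by
  have h1 : AnalyticAt ℂ (fun p : ℂ × (Fin (d + 1) → ℂ) => p.1) p := analyticAt_fst
  have h2 (i : Fin (d + 1)) : AnalyticAt ℂ (fun p : ℂ × (Fin (d + 1) → ℂ) => p.2 i) p :=
    ((ContinuousLinearMap.proj (R := ℂ) (φ := fun _ : Fin (d + 1) => ℂ) i).comp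
      (ContinuousLinearMap.snd ℂ ℂ (Fin (d + 1) → ℂ))).analyticAt p
  exact ((h1.add (h2 0)).sub analyticAt_const).prod (AnalyticAt.pi fun i => h2 i.succ)

omit hq1 in
theorem analyticAt_denom (N d : ℕ) (p : ℂ × (Fin d → ℂ)) :
    AnalyticAt ℂ (fun p : ℂ × (Fin d → ℂ) => denom q N d p.1 p.2) p := by
  induction d with
  | zero => exact analyticAt_const
  | succ d ih =>
    have h1 := (ih (stepMap d p)).comp (analyticAt_stepMap d p)
    have h2 : AnalyticAt ℂ (fun p => den q N (stepMap d p).1) p :=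
      AnalyticAt.fun_comp ((differentiable_den hq0 N).analyticAt _)
        (analyticAt_fst.comp (analyticAt_stepMap d p))
    exact h2.mul h1

theorem analyticAt_numer (N d : ℕ) (p : ℂ × (Fin d → ℂ)) (hp : Above d (-N) p.1 p.2) :
    AnalyticAt ℂ (fun p : ℂ × (Fin d → ℂ) => numer hq0 hq1 N d p.1 p.2) p := by
  induction d with
  | zero => exact analyticAt_const
  | succ d ih =>
    have hr := sqrt_pos_and_lt_one hq0 hq1
    have h1 := (ih (stepMap d p) hp.2).comp (analyticAt_stepMap d p)
    have h2 : AnalyticAt ℂ (fun p => weightVec q N (stepMap d p).1) p :=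
      AnalyticAt.fun_comp (analyticAt_weightVec hq0 hq1 hp.1)
        (analyticAt_fst.comp (analyticAt_stepMap d p))
    have h3 : AnalyticAt ℂ (fun p : ℂ × (Fin (d + 1) → ℂ) => p.2 0) p :=
      ((ContinuousLinearMap.proj (R := ℂ) (φ := fun _ : Fin (d + 1) => ℂ) 0).comp
        (ContinuousLinearMap.snd ℂ ℂ (Fin (d + 1) → ℂ))).analyticAt p
    have h4 : AnalyticAt ℂ (fun p : ℂ × (Fin (d + 1) → ℂ) => binomOp √q (p.2 0)) p :=
      AnalyticAt.fun_comp (analyticAt_binomOp hr.1.le hr.2 _) h3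
    have h5 : AnalyticAt ℂ (fun p : ℂ × (Fin (d + 1) → ℂ) => (1 - (q : ℂ)) ^ p.2 0) p := by
      refine analyticAt_const.cpow h3 ?_
      have : (1 - (q : ℂ)) = ((1 - q : ℝ) : ℂ) := by push_cast; rfl
      rw [this, Complex.ofReal_mem_slitPlane]
      linarith
    have h6 : AnalyticAt ℂ (fun p : ℂ × (Fin (d + 1) → ℂ) => binomOp √q (p.2 0)
        (weightVec q N (stepMap d p).1 * numer hq0 hq1 N d (stepMap d p).1 (stepMap d p).2)) p :=
      AnalyticAt.comp (f := fun p : ℂ × (Fin (d + 1) → ℂ) => (binomOp √q (p.2 0),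
        weightVec q N (stepMap d p).1 * numer hq0 hq1 N d (stepMap d p).1 (stepMap d p).2))
        (analyticAt_apply _) (h4.prod (h2.mul h1))
    exact h5.smul (analyticAt_const.mul h6)

/-- The recursion for offset x + L involves only the indices L + b, so all integer shifts together
are handled by powers of the left shift. The powers of √q cancel: √q^L √q^b / √q^(L+b) = 1. -/
theorem numer_eq {N d : ℕ} {x : ℂ} {s : Fin d → ℂ} (hA : Above d (-N) x s) (hR : Reg q d x s)
    (L : ℕ) : numer hq0 hq1 N d x s L = denom q N d x s * cont q d (x + L) s := by
  induction d generalizing x L with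
  | zero => simp [numer, denom, cont]
  | succ d ih =>
    have hr := sqrt_pos_and_lt_one hq0 hq1
    have hr0 : (√q : ℂ) ≠ 0 := by exact_mod_cast hr.1.ne'
    rw [numer, denom, cont, BoundedContinuousFunction.smul_apply,
      BoundedContinuousFunction.mul_apply, binomOp_apply hr.1.le hr.2, ← tsum_mul_left, ← tsum_mul_left, ← tsum_mul_left, smul_eq_mul,
      ← tsum_mul_left]
    refine tsum_congr fun b => ?_
    rw [BoundedContinuousFunction.mul_apply, weightVec_apply hq0 hq1 hA.1, ih hA.2 hR.2,
      weight_eq (hR.1 _)]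
    have e : x + s 0 - 1 + ((L + b : ℕ) : ℂ) = x + L + s 0 - 1 + b := by push_cast; ring
    rw [e, pow_add]
    have e2 : powVec √q hr.1.le hr.2.le L = (√q : ℂ) ^ L := rfl
    rw [e2]
    field_simp

omit hq0 hq1 in
theorem Reg.denom_ne_zero {N d : ℕ} {x : ℂ} {s : Fin d → ℂ} (hR : Reg q d x s) :
    denom q N d x s ≠ 0 := by
  induction d generalizing x with
  | zero => exact one_ne_zero
  | succ d ih =>
    exact mul_ne_zero (Finset.prod_ne_zero_iff.2 fun L _ => sub_ne_zero.2 (hR.1 L).symm) (ih hR.2)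

/-- Factors with L ≥ N cannot vanish, since there Re(w + L) > 0 and |q^(w+L)| < 1. The infinitely
many regularity conditions thus reduce locally to one non-vanishing condition. -/
theorem reg_of_denom_ne_zero {N d : ℕ} {x : ℂ} {s : Fin d → ℂ} (hA : Above d (-N) x s)
    (h : denom q N d x s ≠ 0) : Reg q d x s := by
  induction d generalizing x with
  | zero => trivial
  | succ d ih =>
    refine ⟨fun L => ?_, ih hA.2 (right_ne_zero_of_mul h)⟩
    by_cases hL : L < N
    · exact (sub_ne_zero.1 (Finset.prod_ne_zero_iff.1 (left_ne_zero_of_mul h) L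
        (Finset.mem_range.2 hL))).symm
    · exact cpow_add_natCast_ne_one hq0 hq1 hA.1 (not_lt.1 hL)

theorem Above.reg {d : ℕ} {x : ℂ} {s : Fin d → ℂ} (h : Above d 0 x s) : Reg q d x s := by
  induction d generalizing x with
  | zero => trivial
  | succ d ih =>
    exact ⟨fun L => cpow_add_natCast_ne_one (N := 0) hq0 hq1 (by simpa using h.1) (Nat.zero_le _),
      ih h.2⟩

omit hq0 hq1 in
theorem Reg.add_natCast {d : ℕ} {x : ℂ} {s : Fin d → ℂ} (h : Reg q d x s) (n : ℕ) :
    Reg q d (x + n) s := by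
  induction d generalizing x with
  | zero => trivial
  | succ d ih =>
    have e : x + n + s 0 - 1 = x + s 0 - 1 + n := by ring
    refine ⟨fun L => ?_, ?_⟩
    · have := h.1 (n + L)
      rwa [e, add_assoc, ← Nat.cast_add]
    · rw [e]; exact ih h.2

omit hq0 hq1 in
theorem reg_headShift {d : ℕ} {x y : ℂ} {s : Fin (d + 1) → ℂ} :
    Reg q (d + 1) x (headShift s y) ↔ Reg q (d + 1) (x + y) s := by
  have e : x + (s 0 + y) - 1 = x + y + s 0 - 1 := by ring
  simp only [Reg, headShift, Fin.cons_zero, Fin.tail_cons, e]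

omit hq0 hq1 in
theorem Reg.merge {m : ℕ} {x y : ℂ} {s : Fin (m + 2) → ℂ} (h : Reg q (m + 2) (x + y + 1) s) :
    Reg q (m + 1) x (merge s y) := by
  have e : x + (s 0 + s 1 + y) - 1 = x + y + 1 + s 0 - 1 + Fin.tail s 0 - 1 := by
    simp [Fin.tail]; ring
  have h2 := h.2
  simp only [Reg] at h2 ⊢
  simp only [BZ.merge, Fin.cons_zero, e]
  exact h2

theorem isOpen_reg (d : ℕ) : IsOpen {p : ℂ × (Fin d → ℂ) | Reg q d p.1 p.2} := by
  refine isOpen_iff_mem_nhds.2 fun p hp => ?_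
  obtain ⟨N, hN⟩ := exists_above d p.1 p.2
  have h1 : ∀ᶠ z : ℂ × (Fin d → ℂ) in 𝓝 p, Above d (-N) z.1 z.2 :=
    (isOpen_above d (-N)).mem_nhds hN
  have h2 := (analyticAt_denom hq0 N d p).continuousAt.eventually_ne (Reg.denom_ne_zero hp)
  filter_upwards [h1, h2] with z hz1 hz2 using reg_of_denom_ne_zero hq0 hq1 hz1 hz2

theorem countable_cpow_eq_one (y : ℂ) : {x : ℂ | (q : ℂ) ^ (x + y) = 1}.Countable := by
  have hl : Complex.log q ≠ 0 := by
    rw [← Complex.ofReal_log hq0.le]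
    exact_mod_cast (Real.log_neg hq0 hq1).ne
  refine (Set.countable_range fun n : ℤ =>
    n * (2 * Real.pi * Complex.I) / Complex.log q - y).mono ?_
  intro x hx
  rw [Set.mem_ofPred_eq, Complex.cpow_def_of_ne_zero (ofReal_q_ne_zero hq0),
    Complex.exp_eq_one_iff] at hx
  obtain ⟨n, hn⟩ := hx
  refine ⟨n, ?_⟩
  simp only [← hn]
  field_simp
  ring

/-- Along this line each condition q^(x+c) = 1 excludes a countable set of x, and there are
countably many conditions. -/
theorem countable_not_reg (d : ℕ) (y : ℂ) (s : Fin d → ℂ) :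
    {x : ℂ | ¬ Reg q d (x + y) s}.Countable := by
  induction d generalizing y with
  | zero => simp [Reg]
  | succ d ih =>
    refine ((Set.countable_iUnion fun L : ℕ =>
      countable_cpow_eq_one hq0 hq1 (y + s 0 - 1 + L)).union
        (ih (y + s 0 - 1) (Fin.tail s))).mono ?_
    intro x hx
    by_contra h
    simp only [Set.mem_union, Set.mem_iUnion, Set.mem_ofPred_eq, not_or, not_exists, not_not] at h
    refine hx ⟨fun L => ?_, ?_⟩
    · have := h.1 L
      rwa [show x + (y + s 0 - 1 + L) = x + y + s 0 - 1 + L by ring] at this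
    · have := h.2
      rwa [show x + (y + s 0 - 1) = x + y + s 0 - 1 by ring] at this

end

/-! ### Series dominated from some index on, and analyticity of their terms -/

/-- The first n terms, where no uniform bound is available, are split off as a finite sum; dominated
convergence treats the rest. -/
theorem summable_and_continuousAt_tsum {f : ℕ → ℂ → ℂ} {z : ℂ} {n : ℕ} {u : ℕ → ℝ}
    (hu : Summable u) (hb : ∀ᶠ y in 𝓝 z, ∀ k, ‖f (k + n) y‖ ≤ u k)
    (hf : ∀ k, ContinuousAt (f k) z) :
    Summable (fun k => f k z) ∧ ContinuousAt (fun y => ∑' k, f k y) z := by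
  have hs : ∀ᶠ y in 𝓝 z, Summable fun k => f k y := hb.mono fun y hy =>
    (summable_nat_add_iff n).1 (hu.of_norm_bounded hy)
  refine ⟨hs.self_of_nhds, ?_⟩
  have h1 : ContinuousAt (fun y => ∑ k ∈ Finset.range n, f k y + ∑' k, f (k + n) y) z := by
    refine ContinuousAt.add ?_ (tendsto_tsum_of_dominated_convergence hu (fun k => hf (k + n)) hb)
    exact tendsto_finsetSum _ fun k _ => hf k
  refine h1.congr (hs.mono fun y hy => ?_)
  exact hy.sum_add_tsum_nat_add n

theorem differentiableOn_tsum_of_eventually_bounded {f : ℕ → ℂ → ℂ} {U : Set ℂ} (hU : IsOpen U)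
    (hf : ∀ k, DifferentiableOn ℂ (f k) U)
    (hb : ∀ z ∈ U, ∃ (n : ℕ) (u : ℕ → ℝ), Summable u ∧
      ∀ᶠ y in 𝓝 z, ∀ k, ‖f (k + n) y‖ ≤ u k) :
    DifferentiableOn ℂ (fun y => ∑' k, f k y) U := by
  intro z hz
  obtain ⟨n, u, hu, hb⟩ := hb z hz
  obtain ⟨V, hV, hVo, hzV⟩ := eventually_nhds_iff.1 (hb.and (hU.mem_nhds hz))
  have h1 : DifferentiableOn ℂ
      (fun y => ∑ k ∈ Finset.range n, f k y + ∑' k, f (k + n) y) V := by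
    refine DifferentiableOn.add (DifferentiableOn.fun_sum fun k _ =>
      (hf k).mono fun y hy => (hV y hy).2) ?_
    exact Complex.differentiableOn_tsum_of_summable_norm hu
      (fun k => (hf (k + n)).mono fun y hy => (hV y hy).2) hVo fun k y hy => (hV y hy).1 k
  refine DifferentiableAt.differentiableWithinAt ?_
  refine (h1.differentiableAt (hVo.mem_nhds hzV)).congr_of_eventuallyEq ?_
  filter_upwards [hVo.mem_nhds hzV] with y hy
  exact (((summable_nat_add_iff n).1 (hu.of_norm_bounded (hV y hy).1)).sum_add_tsum_nat_add
    n).symm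

theorem analyticAt_apply_fin {d : ℕ} (i : Fin d) (s : Fin d → ℂ) :
    AnalyticAt ℂ (fun t : Fin d → ℂ => t i) s :=
  (ContinuousLinearMap.proj (R := ℂ) (φ := fun _ : Fin d => ℂ) i).analyticAt s

theorem analyticAt_fin_cons {d : ℕ} {E : Type*} [NormedAddCommGroup E] [NormedSpace ℂ E]
    {f : E → ℂ} {g : E → Fin d → ℂ} {e : E} (hf : AnalyticAt ℂ f e)
    (hg : ∀ i, AnalyticAt ℂ (fun y => g y i) e) :
    AnalyticAt ℂ (fun y => (Fin.cons (f y) (g y) : Fin (d + 1) → ℂ)) e := by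
  refine AnalyticAt.pi fun i => ?_
  refine Fin.cases ?_ (fun i => ?_) i
  · simpa only [Fin.cons_zero] using hf
  · simpa only [Fin.cons_succ] using hg i

theorem analyticAt_merge {m : ℕ} (a : ℂ) (s : Fin (m + 2) → ℂ) :
    AnalyticAt ℂ (fun t : Fin (m + 2) → ℂ => merge t a) s :=
  analyticAt_fin_cons (((analyticAt_apply_fin 0 s).add (analyticAt_apply_fin 1 s)).add
    analyticAt_const) fun i => analyticAt_apply_fin i.succ.succ s

theorem analyticAt_shift {m : ℕ} (a : ℂ) (s : Fin (m + 2) → ℂ) :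
    AnalyticAt ℂ (fun t : Fin (m + 2) → ℂ => shift t a) s :=
  analyticAt_fin_cons ((analyticAt_apply_fin 0 s).add analyticAt_const)
    fun i => analyticAt_apply_fin i.succ s

theorem analyticAt_shift_right {m : ℕ} (s : Fin (m + 2) → ℂ) (z : ℂ) :
    AnalyticAt ℂ (fun y : ℂ => shift s y) z :=
  analyticAt_fin_cons (analyticAt_const.add analyticAt_id) fun _ => analyticAt_const

theorem analyticAt_rcoef_apply {m : ℕ} (k : ℕ) (s : Fin (m + 1) → ℂ) :
    AnalyticAt ℂ (fun t : Fin (m + 1) → ℂ => rcoef (t 0) k) s :=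
  AnalyticAt.fun_comp ((differentiable_rcoef k).analyticAt _) (analyticAt_apply_fin 0 s)

theorem analyticAt_leftTerm (q : ℝ) {m : ℕ} {G : (Fin (m + 1) → ℂ) → ℂ} {s : Fin (m + 2) → ℂ}
    {k : ℕ} (h1 : AnalyticAt ℂ G (merge s k)) (h2 : AnalyticAt ℂ G (merge s ((k : ℂ) - 1))) :
    AnalyticAt ℂ (leftTerm q G k) s :=
  (analyticAt_const.mul (analyticAt_rcoef_apply k s)).mul
    ((h1.fun_comp (f := fun t => merge t k) (analyticAt_merge _ s)).add
      (analyticAt_const.mul (h2.fun_comp (f := fun t => merge t ((k : ℂ) - 1)) (analyticAt_merge _ s))))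

theorem analyticAt_rightTerm {m : ℕ} {F : (Fin (m + 2) → ℂ) → ℂ} {s : Fin (m + 2) → ℂ}
    {k : ℕ} (h : AnalyticAt ℂ F (shift s ((k : ℂ) + 1))) : AnalyticAt ℂ (rightTerm F k) s :=
  (analyticAt_const.mul (analyticAt_rcoef_apply (k + 1) s)).mul
    (h.fun_comp (f := fun t => shift t ((k : ℂ) + 1)) (analyticAt_shift _ s))

theorem shift_zero {m : ℕ} (s : Fin (m + 2) → ℂ) : shift s 0 = s := headShift_zero s

/-! ### The meromorphic extension and the continued formula -/

section

variable {q : ℝ} (hq0 : 0 < q) (hq1 : q < 1)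

/-- The meromorphic continuation of `zeta q d`, with removable singularities removed. -/
def extension (q : ℝ) (d : ℕ) (s : Fin d → ℂ) : ℂ :=
  limUnder (𝓝[{t | Reg q d 0 t}] s) (cont q d 0)

include hq0 hq1

theorem analyticAt_numer_zero {N d : ℕ} {s : Fin d → ℂ} (hA : Above d (-N) 0 s) :
    AnalyticAt ℂ (fun t => numer hq0 hq1 N d 0 t 0) s := by
  have h1 : AnalyticAt ℂ (fun t : Fin d → ℂ => ((0 : ℂ), t)) s := analyticAt_const.prod analyticAt_id
  have h2 := AnalyticAt.comp (f := fun t : Fin d → ℂ => ((0 : ℂ), t))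
    (analyticAt_numer hq0 hq1 N d (0, s) hA) h1
  exact ((BoundedContinuousFunction.evalCLM ℂ (0 : ℕ)).analyticAt _).fun_comp h2

omit hq1 in
theorem analyticAt_denom_zero (N : ℕ) {d : ℕ} (s : Fin d → ℂ) :
    AnalyticAt ℂ (fun t => denom q N d 0 t) s := by
  have h1 : AnalyticAt ℂ (fun t : Fin d → ℂ => ((0 : ℂ), t)) s := analyticAt_const.prod analyticAt_id
  exact AnalyticAt.comp (f := fun t : Fin d → ℂ => ((0 : ℂ), t))
    (analyticAt_denom hq0 N d (0, s)) h1

theorem cont_eq_div {N d : ℕ} {s : Fin d → ℂ} (hA : Above d (-N) 0 s)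
    (h : denom q N d 0 s ≠ 0) :
    cont q d 0 s = numer hq0 hq1 N d 0 s 0 / denom q N d 0 s := by
  rw [numer_eq hq0 hq1 hA (reg_of_denom_ne_zero hq0 hq1 hA h), mul_div_cancel_left₀ _ h,
    Nat.cast_zero, add_zero]

omit hq0 hq1 in
theorem eventually_above {d : ℕ} {a : ℝ} {s : Fin d → ℂ} (h : Above d a 0 s) :
    ∀ᶠ t in 𝓝 s, Above d a 0 t :=
  ((isOpen_above d a).preimage (f := fun t : Fin d → ℂ => ((0 : ℂ), t)) (by fun_prop)).mem_nhds h

theorem eventually_reg {d : ℕ} {s : Fin d → ℂ} (h : Reg q d 0 s) :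
    ∀ᶠ t in 𝓝 s, Reg q d 0 t :=
  ((isOpen_reg hq0 hq1 d).preimage (f := fun t : Fin d → ℂ => ((0 : ℂ), t))
    (by fun_prop)).mem_nhds h

theorem analyticAt_cont {d : ℕ} {s : Fin d → ℂ} (h : Reg q d 0 s) :
    AnalyticAt ℂ (cont q d 0) s := by
  obtain ⟨N, hN⟩ := exists_above d 0 s
  refine ((analyticAt_numer_zero hq0 hq1 hN).fun_div (analyticAt_denom_zero hq0 N s)
    h.denom_ne_zero).congr ?_
  filter_upwards [eventually_above hN, eventually_reg hq0 hq1 h] with t h1 h2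
  exact (cont_eq_div hq0 hq1 h1 h2.denom_ne_zero).symm

theorem extension_eq_cont {d : ℕ} {s : Fin d → ℂ} (h : Reg q d 0 s) :
    extension q d s = cont q d 0 s := by
  have : NeBot (𝓝[{t | Reg q d 0 t}] s) :=
    mem_closure_iff_nhdsWithin_neBot.1 (subset_closure h)
  exact ((analyticAt_cont hq0 hq1 h).continuousAt.mono_left nhdsWithin_le_nhds).limUnder_eq

theorem analyticAt_extension {d : ℕ} {s : Fin d → ℂ} (h : Reg q d 0 s) :
    AnalyticAt ℂ (extension q d) s :=
  (analyticAt_cont hq0 hq1 h).congr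
    ((eventually_reg hq0 hq1 h).mono fun _ ht => (extension_eq_cont hq0 hq1 ht).symm)

theorem eqOn_extension_zeta (d : ℕ) : Set.EqOn (extension q d) (zeta q d) (domain d) :=
  fun s hs => by
    rw [extension_eq_cont hq0 hq1 (Above.reg hq0 hq1 (mem_domain_iff.1 hs)),
      cont_eq_zeta hq0 hq1 hs]

theorem dense_reg (d : ℕ) (s : Fin d → ℂ) : Dense {z : ℂ | Reg q d z s} := by
  have h := (countable_not_reg hq0 hq1 d 0 s).dense_compl ℝ
  have e : {x : ℂ | ¬ Reg q d (x + 0) s}ᶜ = {z : ℂ | Reg q d z s} := by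
    ext z; simp
  rwa [e] at h

/-- The denominator is not locally zero because regular points are dense on the line through p in
the first coordinate; positive depth supplies that coordinate. -/
theorem isMeromorphic_extension (d : ℕ) : IsMeromorphic (extension q (d + 1)) := by
  intro p
  obtain ⟨N, hN⟩ := exists_above (d + 1) 0 p
  refine ⟨_, _, analyticAt_numer_zero hq0 hq1 hN, analyticAt_denom_zero hq0 N p, fun h => ?_, ?_⟩
  · have hc : ContinuousAt (fun z : ℂ => headShift p z) 0 :=
      (continuous_headShift.comp (continuous_const.prodMk continuous_id)).continuousAt
    have h1 : ∀ᶠ z : ℂ in 𝓝 0, denom q N (d + 1) 0 (headShift p z) = 0 :=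
      hc.eventually (p := fun t => denom q N (d + 1) 0 t = 0) (by beta_reduce; rwa [headShift_zero])
    obtain ⟨z, hz1, hz2⟩ := (dense_reg hq0 hq1 (d + 1) p).inter_nhds_nonempty h1
    have h3 : Reg q (d + 1) 0 (headShift p z) := by
      rw [reg_headShift, zero_add]; exact hz1
    exact h3.denom_ne_zero hz2
  · filter_upwards [eventually_above hN] with t ht h
    rw [extension_eq_cont hq0 hq1 (reg_of_denom_ne_zero hq0 hq1 ht h), cont_eq_div hq0 hq1 ht h]

omit hq0 hq1 in
-- Of the shift N + 1, N units compensate the lower bound -N of the partial sums at z, and one unit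
-- compensates Re(y - z) ≥ -1.
theorem exists_shift_mem_domain {m : ℕ} (s : Fin (m + 2) → ℂ) (z : ℂ) :
    ∃ n : ℕ, ∀ y ∈ Metric.closedBall z 1, shift (shift s y) n ∈ domain (m + 2) := by
  obtain ⟨N, hN⟩ := exists_above (m + 2) z s
  refine ⟨N + 1, fun y hy => ?_⟩
  rw [mem_domain_iff, shift_eq_headShift, shift_eq_headShift, above_headShift, above_headShift]
  have h1 : -1 ≤ (y - z).re :=
    (abs_le.1 ((Complex.abs_re_le_norm _).trans (mem_closedBall_iff_norm.1 hy))).1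
  have h2 := hN.add_right (y := y - z + ((N + 1 : ℕ) : ℂ)) (b := N) (by
    rw [Complex.add_re, Complex.natCast_re]; push_cast; linarith)
  rw [neg_add_cancel] at h2
  rwa [show 0 + ((N + 1 : ℕ) : ℂ) + y = z + (y - z + ((N + 1 : ℕ) : ℂ)) by ring]

theorem exists_eventually_bound {m : ℕ} (s : Fin (m + 2) → ℂ) (z : ℂ) :
    (∃ (n : ℕ) (u : ℕ → ℝ), Summable u ∧ ∀ᶠ y in 𝓝 z, ∀ k,
      ‖leftTerm q (extension q (m + 1)) (k + n) (shift s y)‖ ≤ u k) ∧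
    ∃ (n : ℕ) (u : ℕ → ℝ), Summable u ∧ ∀ᶠ y in 𝓝 z, ∀ k,
      ‖rightTerm (extension q (m + 2)) (k + n) (shift s y)‖ ≤ u k := by
  obtain ⟨n, hn⟩ := exists_shift_mem_domain s z
  have hK : IsCompact ((fun y => shift s y) '' Metric.closedBall z 1) :=
    (isCompact_closedBall z 1).image
      (continuous_iff_continuousAt.2 fun y => (analyticAt_shift_right s y).continuousAt)
  have hd : ∀ t ∈ (fun y => shift s y) '' Metric.closedBall z 1, shift t n ∈ domain (m + 2) := by
    rintro _ ⟨y, hy, rfl⟩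
    exact hn y hy
  obtain ⟨u, hu, hbu⟩ := exists_summable_bound_leftTerm hq0 hq1
    (eqOn_extension_zeta hq0 hq1 (m + 1)) hK hd
  obtain ⟨v, hv, hbv⟩ := exists_summable_bound_rightTerm hq0 hq1
    (eqOn_extension_zeta hq0 hq1 (m + 2)) hK hd
  have hz := Metric.closedBall_mem_nhds z one_pos
  exact ⟨⟨n, u, hu, mem_of_superset hz fun y hy k => hbu k _ ⟨y, hy, rfl⟩⟩,
    ⟨n, v, hv, mem_of_superset hz fun y hy k => hbv k _ ⟨y, hy, rfl⟩⟩⟩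

/-- Regularity persists under shifts by natural numbers, and the partial sums of a merged tuple are
among those of the shifted original. -/
theorem isRegularPoint_of_reg {m : ℕ} {s : Fin (m + 2) → ℂ} (h : Reg q (m + 2) 0 s) :
    IsRegularPoint (extension q (m + 1)) (extension q (m + 2)) s := by
  refine ⟨analyticAt_extension hq0 hq1 h, fun k => ?_, fun k => ?_⟩
  · refine analyticAt_extension hq0 hq1 ?_
    rw [shift_eq_headShift, reg_headShift]
    exact_mod_cast h.add_natCast (k + 1)
  · refine analyticAt_extension hq0 hq1 (Reg.merge ?_)
    have := h.add_natCast k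
    rwa [show (0 : ℂ) + ((k : ℂ) - 1) + 1 = 0 + k by ring]

omit hq0 hq1 in
theorem IsRegularPoint.analyticAt_leftTerm {m : ℕ} {G : (Fin (m + 1) → ℂ) → ℂ}
    {F : (Fin (m + 2) → ℂ) → ℂ} {s : Fin (m + 2) → ℂ} (h : IsRegularPoint G F s) (k : ℕ) :
    AnalyticAt ℂ (leftTerm q G k) s := by
  refine BZ.analyticAt_leftTerm q ?_ (h.2.2 k)
  have := h.2.2 (k + 1)
  rwa [Nat.cast_add, Nat.cast_one, add_sub_cancel_right] at this

omit hq1 in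
theorem analyticAt_boundary {m : ℕ} {F : (Fin (m + 2) → ℂ) → ℂ} {s : Fin (m + 2) → ℂ}
    (h : AnalyticAt ℂ F s) :
    AnalyticAt ℂ (fun t : Fin (m + 2) → ℂ => ((q : ℂ) ^ (-(t 0 - 1)) - 1) * F t) s := by
  refine AnalyticAt.mul (AnalyticAt.sub (AnalyticAt.cpow analyticAt_const
    (((analyticAt_apply_fin 0 s).sub analyticAt_const).neg) ?_) analyticAt_const) h
  exact Complex.ofReal_mem_slitPlane.2 hq0

/-- Identity theorem on the regular part of a complex line. It is open, connected as the complement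
of a countable set in the plane, and contains a point whose shift lies in the domain, where the
formula is known. -/
theorem tsum_eq_on_line {m : ℕ} (s : Fin (m + 2) → ℂ) :
    Set.EqOn (fun z => ∑' k, leftTerm q (extension q (m + 1)) k (shift s z))
      (fun z => ∑' k, rightTerm (extension q (m + 2)) k (shift s z) +
        ((q : ℂ) ^ (-(shift s z 0 - 1)) - 1) * extension q (m + 2) (shift s z))
      {z | Reg q (m + 2) z s} := by
  set D := {z : ℂ | Reg q (m + 2) z s} with hD
  have hDo : IsOpen D := (isOpen_reg hq0 hq1 (m + 2)).preimage (f := fun z : ℂ => (z, s))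
    (by fun_prop)
  have hDc : IsPreconnected D := by
    have h := ((countable_not_reg hq0 hq1 (m + 2) 0 s).isConnected_compl_of_one_lt_rank
      (by simp)).isPreconnected
    have e : {x : ℂ | ¬ Reg q (m + 2) (x + 0) s}ᶜ = D := by
      ext z; simp [hD]
    rwa [e] at h
  have hreg (z : ℂ) (hz : z ∈ D) :
      IsRegularPoint (extension q (m + 1)) (extension q (m + 2)) (shift s z) := by
    refine isRegularPoint_of_reg hq0 hq1 ?_
    rw [shift_eq_headShift, reg_headShift, zero_add]
    exact hz
  have hl : DifferentiableOn ℂ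
      (fun z => ∑' k, leftTerm q (extension q (m + 1)) k (shift s z)) D :=
    differentiableOn_tsum_of_eventually_bounded hDo (fun k z hz =>
      (((hreg z hz).analyticAt_leftTerm k).fun_comp
        (analyticAt_shift_right s z)).differentiableAt.differentiableWithinAt)
      fun z _ => (exists_eventually_bound hq0 hq1 s z).1
  have hr : DifferentiableOn ℂ (fun z => ∑' k, rightTerm (extension q (m + 2)) k (shift s z)) D :=
    differentiableOn_tsum_of_eventually_bounded hDo (fun k z hz =>
      ((analyticAt_rightTerm ((hreg z hz).2.1 k)).fun_comp
        (analyticAt_shift_right s z)).differentiableAt.differentiableWithinAt)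
      fun z _ => (exists_eventually_bound hq0 hq1 s z).2
  have hb : DifferentiableOn ℂ (fun z => ((q : ℂ) ^ (-(shift s z 0 - 1)) - 1) *
      extension q (m + 2) (shift s z)) D := fun z hz =>
    ((analyticAt_boundary hq0 (hreg z hz).1).fun_comp
      (analyticAt_shift_right s z)).differentiableAt.differentiableWithinAt
  obtain ⟨n, hn⟩ := exists_shift_mem_domain s 0
  have hn0 : shift s (n : ℂ) ∈ domain (m + 2) := by
    have := hn 0 (Metric.mem_closedBall_self zero_le_one)
    rwa [shift_zero] at this
  have hnD : (n : ℂ) ∈ D := by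
    have := Above.reg hq0 hq1 (mem_domain_iff.1 hn0)
    rwa [shift_eq_headShift, reg_headShift, zero_add] at this
  refine (hl.analyticOnNhd hDo).eqOn_of_preconnected_of_eventuallyEq
    ((hr.add hb).analyticOnNhd hDo) hDc hnD ?_
  filter_upwards [(analyticAt_shift_right s n).continuousAt.preimage_mem_nhds
    ((isOpen_domain (m + 2)).mem_nhds hn0)] with z hz
  exact (translationFormula_of_mem_domain hq0 hq1 (eqOn_extension_zeta hq0 hq1 (m + 1))
    (eqOn_extension_zeta hq0 hq1 (m + 2)) hz).2.2

/-- The point may lie on one of the excluded hyperplanes if the singularities there cancel. Both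
sides are still continuous along the line at z = 0, and the formula holds at a dense set of nearby
z. -/
theorem translationFormula_of_isRegularPoint {m : ℕ} {s : Fin (m + 2) → ℂ}
    (h : IsRegularPoint (extension q (m + 1)) (extension q (m + 2)) s) :
    TranslationFormula q (extension q (m + 1)) (extension q (m + 2)) s := by
  obtain ⟨⟨n, u, hu, hbu⟩, n', v, hv, hbv⟩ := exists_eventually_bound hq0 hq1 s 0
  have e0 := shift_zero s
  have hs := analyticAt_shift_right s 0
  obtain ⟨h1, hc1⟩ := summable_and_continuousAt_tsum
    (f := fun k z => leftTerm q (extension q (m + 1)) k (shift s z)) hu hbu fun k =>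
      (AnalyticAt.fun_comp (by rw [e0]; exact h.analyticAt_leftTerm k) hs).continuousAt
  obtain ⟨h2, hc2⟩ := summable_and_continuousAt_tsum
    (f := fun k z => rightTerm (extension q (m + 2)) k (shift s z)) hv hbv fun k =>
      (AnalyticAt.fun_comp (by rw [e0]; exact analyticAt_rightTerm (h.2.1 k)) hs).continuousAt
  have hc3 : ContinuousAt (fun z => ((q : ℂ) ^ (-(shift s z 0 - 1)) - 1) *
      extension q (m + 2) (shift s z)) 0 :=
    (AnalyticAt.fun_comp (g := fun t : Fin (m + 2) → ℂ => ((q : ℂ) ^ (-(t 0 - 1)) - 1) *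
      extension q (m + 2) t) (by rw [e0]; exact analyticAt_boundary hq0 h.1) hs).continuousAt
  have hne : NeBot (𝓝[{z : ℂ | Reg q (m + 2) z s}] 0) :=
    mem_closure_iff_nhdsWithin_neBot.1 (dense_reg hq0 hq1 (m + 2) s 0)
  have h3 := tendsto_nhds_unique_of_eventuallyEq (hc1.mono_left nhdsWithin_le_nhds)
    ((hc2.add hc3).mono_left nhdsWithin_le_nhds)
    (eventually_nhdsWithin_of_forall (tsum_eq_on_line hq0 hq1 s))
  simp only [Pi.add_apply, e0] at h1 h2 h3
  exact ⟨h1, h2, h3⟩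

end

end BZ

end

theorem mainTheorem8 (q : ℝ) (hq0 : 0 < q) (hq1 : q < 1) :
    ∃ F : (d : ℕ) → (Fin d → ℂ) → ℂ,
      -- in every depth, `F d` is a meromorphic continuation of the BZ model to `ℂ ^ d`,
      -- and the defining series converges normally on compact subsets of its domain
      (∀ d : ℕ, 1 ≤ d →
        BZ.IsMeromorphic (F d) ∧
        Set.EqOn (F d) (BZ.zeta q d) (BZ.domain d) ∧
        ∀ K : Set (Fin d → ℂ), IsCompact K → K ⊆ BZ.domain d →
          BZ.NormallyConvergentOn (BZ.term q d) K) ∧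
      -- depth `r = m + 2`
      ∀ m : ℕ,
        -- the translation formula, on the domain of the series
        (∀ s ∈ BZ.domain (m + 2), BZ.TranslationFormula q (F (m + 1)) (F (m + 2)) s) ∧
        -- the translation formula on `ℂ ^ r`, away from the poles
        (∀ s : Fin (m + 2) → ℂ, BZ.IsRegularPoint (F (m + 1)) (F (m + 2)) s →
          BZ.TranslationFormula q (F (m + 1)) (F (m + 2)) s) ∧
        -- normal convergence of both series in the translation formula
        ∀ K : Set (Fin (m + 2) → ℂ), IsCompact K → K ⊆ BZ.domain (m + 2) →
          BZ.NormallyConvergentOn (BZ.leftTerm q (F (m + 1))) K ∧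
          BZ.NormallyConvergentOn (BZ.rightTerm (F (m + 2))) K := by
  have hz := BZ.eqOn_extension_zeta hq0 hq1
  refine ⟨BZ.extension q, fun d hd => ⟨?_, hz d, fun K => BZ.normallyConvergentOn_term hq0 hq1⟩,
    fun m => ⟨fun s hs => BZ.translationFormula_of_mem_domain hq0 hq1 (hz _) (hz _) hs,
      fun s hs => BZ.translationFormula_of_isRegularPoint hq0 hq1 hs, fun K hK hKd => ?_⟩⟩
  · obtain ⟨d, rfl⟩ := Nat.exists_eq_add_of_le' hd
    exact BZ.isMeromorphic_extension hq0 hq1 d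
  -- With n = 0 the tail bounds cover the whole series.
  · have h : ∀ s ∈ K, BZ.shift s ((0 : ℕ) : ℂ) ∈ BZ.domain (m + 2) := fun s hs => by
      rw [Nat.cast_zero, BZ.shift_zero]; exact hKd hs
    obtain ⟨u, hu, hbu⟩ := BZ.exists_summable_bound_leftTerm hq0 hq1 (hz (m + 1)) hK h
    obtain ⟨v, hv, hbv⟩ := BZ.exists_summable_bound_rightTerm hq0 hq1 (hz (m + 2)) hK h
    exact ⟨⟨u, hu, hbu⟩, ⟨v, hv, hbv⟩⟩
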